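/- Let $N\ge 1$ be an integer and let $a>-1$, $b>0$, $\beta\ge 0$ be real. For $p=0,1,\dots,N$ and $t\in\mathbb R$ let $$H_p(t)=\frac1{\binom Np}\int_0^1dx_1\cdots\int_0^1dx_N\,\delta\Big(t-\sum_{l=1}^Nx_l\Big)\prod_{l=1}^Nx_l^{a}(1-x_l)^{b-1}\prod_{1\le j<k\le N}|x_k-x_j|^\beta\,e_p(1-x_1,\dots,1-x_N),$$ where $e_p$ is the $p$-th elementary symmetric polynomial and the delta function means that the integration over $x_N$ is carried out by setting $x_N=t-\sum_{l<N}x_l$ (the integrand being zero outside $(0,1)^N$). Let $\mathbf H(t)=[H_p(t)]_{p=0}^N$ (a column vector), $\mathbf P=\big[\binom{N-j}{N-k}\big]_{j,k=0}^N$ and $\mathbf G(t)=\mathbf P^{-1}\mathbf H(t)$. Let $\mathbf\Lambda=-\mathrm{diag}[N,N-1,\dots,1,0]$ and let $\mathbf X=[x_{jk}]_{j,k=0}^N$ be the tridiagonal matrix with $x_{j,j-1}=u_j$, $x_{jj}=v_j$, $x_{j,j+1}=w_j$ and all other entries $0$, where \begin{align*} u_j&=-j\Big(\frac{\beta N}2+b\Big)+\frac\beta2j^2,\\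 v_j&=\Big(a+b+1+\frac\beta2(2N-1)\Big)j-\frac\beta2(N-j)(2j+1)+\Big(\frac{\beta N}2+b\Big)(N-2j)-1,\\ w_j&=\Big(a+b+1+\frac\beta2(2N-1)\Big)(j-N)+\frac\beta2(N-j)(N-j-1)+\Big(\frac{\beta N}2+b\Big)(N-j). \end{align*} Then for every real $t\notin\{0,1,\dots,N\}$ the integrals $H_0(t),\dots,H_N(t)$ converge absolutely and $\mathbf G$ is differentiable at $t$; and $$(\mathbf\Lambda+t\,\mathbf I_{N+1})\,\frac{d}{dt}\mathbf G(t)=\mathbf X\,\mathbf G(t)$$ holds for all these $t$, as well as at any $t\in\{0,1,\dots,N\}$ at which the integrals converge absolutely and $\mathbf G$ is differentiable. -/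

import Mathlib

open scoped Matrix

noncomputable section

namespace JacobiTrace

/-- The point of the hyperplane `∑ x_l = t` in `ℝ^N` (`N ≥ 1`) whose first `N - 1` coordinates are
`y`, and whose last coordinate is therefore `t - ∑ y_l`. -/
def slicePoint (N : ℕ) (t : ℝ) (y : Fin (N - 1) → ℝ) : Fin N → ℝ :=
  fun i => if h : (i : ℕ) < N - 1 then y ⟨i, h⟩ else t - ∑ l, y l

/-- The integral `∫ dx_1 ⋯ ∫ dx_N δ(t - ∑ x_l) f(x)` for `N ≥ 1`: the delta function is used to
carry out the integration over the last variable, at fixed values of the other ones. -/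
def deltaIntegral {N : ℕ} (f : (Fin N → ℝ) → ℝ) (t : ℝ) : ℝ :=
  ∫ y : Fin (N - 1) → ℝ, f (slicePoint N t y)

/-- Absolute convergence of the integral `∫ dx_1 ⋯ ∫ dx_N δ(t - ∑ x_l) f(x)`. -/
def DeltaIntegrable {N : ℕ} (f : (Fin N → ℝ) → ℝ) (t : ℝ) : Prop :=
  MeasureTheory.Integrable (fun y : Fin (N - 1) → ℝ => f (slicePoint N t y))

/-- The function
`∏_l x_l^a (1 - x_l)^(b-1) ∏_{j<k} |x_k - x_j|^β e_p(1 - x_1, …, 1 - x_N)`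
on the cube `(0,1)^N`, extended by zero. -/
def integrand (N : ℕ) (a b β : ℝ) (p : ℕ) : (Fin N → ℝ) → ℝ :=
  (Set.univ.pi fun _ : Fin N => Set.Ioo (0 : ℝ) 1).indicator fun x =>
    (∏ l, x l ^ a * (1 - x l) ^ (b - 1)) *
      (∏ j, ∏ k ∈ Finset.Ioi j, |x k - x j| ^ β) *
      MvPolynomial.eval (fun l => 1 - x l) (MvPolynomial.esymm (Fin N) ℝ p)

/-- The integrals `H_p(t)`. -/
def H (N : ℕ) (a b β : ℝ) (p : ℕ) (t : ℝ) : ℝ :=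
  1 / (N.choose p : ℝ) * deltaIntegral (integrand N a b β p) t

/-- The column vector `[H_p(t)]_{p=0}^N`. -/
def vecH (N : ℕ) (a b β : ℝ) (t : ℝ) : Fin (N + 1) → ℝ :=
  fun p => H N a b β p t

/-- The matrix `P = [C(N-j, N-k)]_{j,k=0}^N`. -/
def matP (N : ℕ) : Matrix (Fin (N + 1)) (Fin (N + 1)) ℝ :=
  Matrix.of fun j k => ((N - (j : ℕ)).choose (N - (k : ℕ)) : ℝ)

/-- The matrix `P` is invertible, so that its matrix inverse `P⁻¹` is a genuine inverse. -/
theorem isUnit_det_matP (N : ℕ) : IsUnit (matP N).det := by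
  have h : (matP N).BlockTriangular id := by
    intro j k hkj
    have hkj' : (k : ℕ) < (j : ℕ) := hkj
    have hj := j.isLt
    simp only [matP, Matrix.of_apply, Nat.cast_eq_zero]
    exact Nat.choose_eq_zero_of_lt (by omega)
  rw [Matrix.det_of_isUpperTriangular h]
  simp [matP]

/-- The column vector `G(t) = P⁻¹ H(t)`. -/
def vecG (N : ℕ) (a b β : ℝ) (t : ℝ) : Fin (N + 1) → ℝ :=
  (matP N)⁻¹ *ᵥ vecH N a b β t

/-- The entries `u_j` below the diagonal, as a function of `j`. -/
def entryU (N b β j : ℝ) : ℝ :=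
  -j * (β * N / 2 + b) + β / 2 * j ^ 2

/-- The diagonal entries `v_j`, as a function of `j`. -/
def entryV (N a b β j : ℝ) : ℝ :=
  (a + b + 1 + β / 2 * (2 * N - 1)) * j - β / 2 * (N - j) * (2 * j + 1)
    + (β * N / 2 + b) * (N - 2 * j) - 1

/-- The entries `w_j` above the diagonal, as a function of `j`. -/
def entryW (N a b β j : ℝ) : ℝ :=
  (a + b + 1 + β / 2 * (2 * N - 1)) * (j - N) + β / 2 * (N - j) * (N - j - 1)
    + (β * N / 2 + b) * (N - j)

/-- The tridiagonal matrix `X`. -/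
def matX (N : ℕ) (a b β : ℝ) : Matrix (Fin (N + 1)) (Fin (N + 1)) ℝ :=
  Matrix.of fun j k =>
    if (k : ℕ) + 1 = (j : ℕ) then entryU N b β (j : ℕ)
    else if k = j then entryV N a b β (j : ℕ)
    else if (k : ℕ) = (j : ℕ) + 1 then entryW N a b β (j : ℕ)
    else 0

/-- The matrix `Λ = - diag [N, N-1, …, 1, 0]`. -/
def matΛ (N : ℕ) : Matrix (Fin (N + 1)) (Fin (N + 1)) ℝ :=
  -Matrix.diagonal fun j : Fin (N + 1) => (N : ℝ) - ((j : ℕ) : ℝ)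

end JacobiTrace

end

/-! Put Q(X) = ∏_l (x_l + (1 - x_l) X), with coefficients Q_j. Since Q(1 + X) = ∏_l (1 + (1 - x_l)
X), the matrix `matP` turns the quotients Q_j / C(N,j) into e_p(1 - x) / C(N,p). Hence, off the
integers, G_j(t) is the integral of Q_j / C(N,j) against the Selberg weight over the slice ∑ x_l = t
(`vecG_eq`).

The equation is the divergence theorem for the vector field whose i-th component is x_i (1 - x_i)
times the X^j-coefficient of (X - 1) ∏_{l ≠ i} (x_l + (1 - x_l) X). The factor x_i (1 - x_i) removes
the boundary terms. Applied to a test function φ(∑ x_l), the field gives φ' · (∑ x_l - N + j) Q_j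
(`sum_fieldCoeff`), and its weighted divergence is a combination of Q_{j-1}, Q_j, Q_{j+1} only
(`coeff_divergencePoly`). So ((t - N + j) G_j)' = (X G)_j + G_j weakly. As |x_k - x_j|^β need not be
differentiable, this is proved for a regularized interaction, followed by a dominated limit
(`integral_weak_eq_zero`).

Near a non-integer t some coordinate of each slice point stays away from 0 and 1; eliminating that
coordinate shows that slice integrals converge and are continuous in t
(`deltaIntegrable_and_continuousAt`). A continuous function with a continuous weak derivative is
differentiable (`hasDerivAt_of_weak`), and dividing by t - N + j ≠ 0 gives G differentiable. At an
integer where G is differentiable, the equation is the limit from the right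
(`differential_equation`). -/

open MeasureTheory Filter Topology

noncomputable section

namespace JacobiTrace

/-! ### The one-variable Jacobi weight -/

/-- The Jacobi weight `s ^ a * (1 - s) ^ (b - 1)` on `(0, 1)`, extended by zero. -/
def betaWeight (a b : ℝ) : ℝ → ℝ :=
  (Set.Ioo (0 : ℝ) 1).indicator fun s => s ^ a * (1 - s) ^ (b - 1)

theorem betaWeight_nonneg (a b s : ℝ) : 0 ≤ betaWeight a b s := by
  refine Set.indicator_nonneg (fun s hs => ?_) s
  exact mul_nonneg (Real.rpow_nonneg hs.1.le _) (Real.rpow_nonneg (by linarith [hs.2]) _)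

theorem integrable_betaWeight {a b : ℝ} (ha : -1 < a) (hb : 0 < b) :
    Integrable (betaWeight a b) := by
  have ha' : 0 < a + 1 := by linarith
  have hB := ProbabilityTheory.beta_pos ha' hb
  have h1 : Integrable (ProbabilityTheory.betaPDFReal (a + 1) b) := by
    refine ⟨(ProbabilityTheory.measurable_betaPDFReal _ _).aestronglyMeasurable, ?_⟩
    rw [hasFiniteIntegral_iff_norm]
    have h2 : ∀ x, ENNReal.ofReal ‖ProbabilityTheory.betaPDFReal (a + 1) b x‖
        = ProbabilityTheory.betaPDF (a + 1) b x := by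
      intro x
      rw [ProbabilityTheory.betaPDF, Real.norm_of_nonneg]
      unfold ProbabilityTheory.betaPDFReal
      split_ifs with h
      · have h3 : 0 ≤ 1 - x := by linarith [h.2]
        have := Real.rpow_nonneg h.1.le (a + 1 - 1)
        have := Real.rpow_nonneg h3 (b - 1)
        positivity
      · exact le_rfl
    simp_rw [h2]
    rw [ProbabilityTheory.lintegral_betaPDF_eq_one ha' hb]
    simp
  convert h1.const_mul (ProbabilityTheory.beta (a + 1) b) using 1
  funext x
  unfold betaWeight ProbabilityTheory.betaPDFReal
  rw [Set.indicator_apply]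
  simp only [Set.mem_Ioo, add_sub_cancel_right]
  split_ifs with h
  · field_simp
  · simp

/-! ### Geometry of the slices: exchange of coordinates and disintegration of volume -/

theorem slicePoint_succ {n : ℕ} (t : ℝ) (y : Fin n → ℝ) :
    slicePoint (n + 1) t y = Fin.snoc (α := fun _ => ℝ) y (t - ∑ l, y l) := by
  funext i
  refine Fin.lastCases ?_ (fun i => ?_) i
  · rw [Fin.snoc_last]; simp [slicePoint]
  · rw [Fin.snoc_castSucc]; simp [slicePoint]

theorem slicePoint_last {n : ℕ} (t : ℝ) (y : Fin n → ℝ) :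
    slicePoint (n + 1) t y (Fin.last n) = t - ∑ l, y l := by
  rw [slicePoint_succ, Fin.snoc_last]

theorem slicePoint_castSucc {n : ℕ} (t : ℝ) (y : Fin n → ℝ) (i : Fin n) :
    slicePoint (n + 1) t y i.castSucc = y i := by
  rw [slicePoint_succ, Fin.snoc_castSucc]

theorem sum_slicePoint {n : ℕ} (t : ℝ) (y : Fin n → ℝ) :
    ∑ l, slicePoint (n + 1) t y l = t := by
  rw [Fin.sum_univ_castSucc, slicePoint_last]
  simp only [slicePoint_castSucc]
  ring

theorem continuous_slicePoint (n : ℕ) :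
    Continuous fun p : ℝ × (Fin n → ℝ) => slicePoint (n + 1) p.1 p.2 := by
  refine continuous_pi fun i => ?_
  refine Fin.lastCases ?_ (fun i => ?_) i
  · simp only [slicePoint_last]; fun_prop
  · simp only [slicePoint_castSucc]; fun_prop

theorem deltaIntegral_succ {n : ℕ} (f : (Fin (n + 1) → ℝ) → ℝ) (t : ℝ) :
    deltaIntegral f t = ∫ y : Fin n → ℝ, f (slicePoint (n + 1) t y) := rfl

theorem deltaIntegrable_succ {n : ℕ} (f : (Fin (n + 1) → ℝ) → ℝ) (t : ℝ) :
    DeltaIntegrable f t ↔ Integrable fun y : Fin n → ℝ => f (slicePoint (n + 1) t y) := Iff.rfl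

/-- Exchanging the coordinate `i` of a point of the hyperplane `∑ x_l = t` with the last one, in
terms of its first `n` coordinates. -/
def sliceSwap {n : ℕ} (i : Fin n) (t : ℝ) (y : Fin n → ℝ) : Fin n → ℝ :=
  Function.update y i (t - ∑ l, y l)

theorem sum_update_univ {n : ℕ} (i : Fin n) (y : Fin n → ℝ) (c : ℝ) :
    ∑ l, Function.update y i c l = c + ∑ l, y l - y i := by
  rw [Finset.sum_update_of_mem (Finset.mem_univ i),
    ← Finset.sum_sdiff (Finset.subset_univ {i}) (f := y)]
  simp only [Finset.sum_singleton]
  ring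

theorem sliceSwap_involutive {n : ℕ} (i : Fin n) (t : ℝ) :
    Function.Involutive (sliceSwap i t) := by
  intro y
  unfold sliceSwap
  rw [sum_update_univ]
  simp

theorem slicePoint_sliceSwap {n : ℕ} (i : Fin n) (t : ℝ) (y : Fin n → ℝ) :
    slicePoint (n + 1) t (sliceSwap i t y) =
      slicePoint (n + 1) t y ∘ Equiv.swap i.castSucc (Fin.last n) := by
  funext k
  refine Fin.lastCases ?_ (fun k => ?_) k
  · have h : ∑ l, sliceSwap i t y l = t - ∑ l, y l + ∑ l, y l - y i := sum_update_univ i y _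
    rw [Function.comp_apply, Equiv.swap_apply_right, slicePoint_last, slicePoint_castSucc, h]
    ring
  · rw [slicePoint_castSucc]
    by_cases h : k = i
    · subst h
      simp [sliceSwap, slicePoint_last]
    · have : Equiv.swap i.castSucc (Fin.last n) k.castSucc = k.castSucc :=
        Equiv.swap_apply_of_ne_of_ne (by simpa using h) (Fin.castSucc_lt_last k).ne
      simp [sliceSwap, h, this, slicePoint_castSucc]

/-- The linear part `L` of this affine map is an involution, so its determinant is ±1. Thus the
slice integral does not depend on which variable the delta function eliminates. -/
theorem measurePreserving_sliceSwap {n : ℕ} (i : Fin n) (t : ℝ) :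
    MeasurePreserving (sliceSwap i t) := by
  let L : (Fin n → ℝ) →ₗ[ℝ] (Fin n → ℝ) :=
    { toFun := fun y => sliceSwap i 0 y
      map_add' := by
        intro x y; funext k
        by_cases h : k = i
        · subst h; simp [sliceSwap, Finset.sum_add_distrib]; ring
        · simp [sliceSwap, h]
      map_smul' := by
        intro c y; funext k
        by_cases h : k = i
        · subst h; simp [sliceSwap, Finset.mul_sum]
        · simp [sliceSwap, h] }
  have hLL : L ∘ₗ L = LinearMap.id := LinearMap.ext fun y => sliceSwap_involutive i 0 y
  have hdet : LinearMap.det L * LinearMap.det L = 1 := by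
    rw [← LinearMap.det_comp, hLL, LinearMap.det_id]
  have hne : LinearMap.det L ≠ 0 := left_ne_zero_of_mul_eq_one hdet
  have habs : |(LinearMap.det L)⁻¹| = 1 := by
    rcases mul_self_eq_one_iff.mp hdet with h | h <;> simp [h]
  have hL : MeasurePreserving L := by
    refine ⟨L.continuous_of_finiteDimensional.measurable, ?_⟩
    rw [Real.map_linearMap_volume_pi_eq_smul_volume_pi hne, habs]
    simp
  have := (measurePreserving_add_right (volume : Measure (Fin n → ℝ))
    (Function.update (0 : Fin n → ℝ) i t)).comp hL
  have heq : sliceSwap i t = (fun x => x + Function.update (0 : Fin n → ℝ) i t) ∘ L := by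
    funext y k
    by_cases h : k = i
    · subst h; simp [L, sliceSwap]; ring
    · simp [L, sliceSwap, h]
  rw [heq]
  exact this

/-- `sliceSwap` as a measurable equivalence. -/
def sliceSwapEquiv {n : ℕ} (i : Fin n) (t : ℝ) : (Fin n → ℝ) ≃ᵐ (Fin n → ℝ) :=
  MeasurableEquiv.ofInvolutive (sliceSwap i t) (sliceSwap_involutive i t)
    (measurePreserving_sliceSwap i t).measurable

theorem deltaIntegral_comp_swap {n : ℕ} (f : (Fin (n + 1) → ℝ) → ℝ) (i : Fin (n + 1)) (t : ℝ) :
    deltaIntegral (fun x => f (x ∘ Equiv.swap i (Fin.last n))) t = deltaIntegral f t := by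
  refine Fin.lastCases ?_ (fun i => ?_) i
  · simp
  · simp only [deltaIntegral_succ, ← slicePoint_sliceSwap]
    exact (measurePreserving_sliceSwap i t).integral_comp (sliceSwapEquiv i t).measurableEmbedding
      fun y => f (slicePoint (n + 1) t y)

theorem deltaIntegrable_comp_swap {n : ℕ} (f : (Fin (n + 1) → ℝ) → ℝ) (i : Fin (n + 1)) (t : ℝ) :
    DeltaIntegrable (fun x => f (x ∘ Equiv.swap i (Fin.last n))) t ↔ DeltaIntegrable f t := by
  refine Fin.lastCases ?_ (fun i => ?_) i
  · simp
  · simp only [deltaIntegrable_succ, ← slicePoint_sliceSwap]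
    exact (measurePreserving_sliceSwap i t).integrable_comp_emb
      (sliceSwapEquiv i t).measurableEmbedding (g := fun y => f (slicePoint (n + 1) t y))

/-- Integration over `ℝ^(n+1)` as integration over the hyperplanes `∑ x_l = t`. -/
theorem measurePreserving_slicePoint (n : ℕ) :
    MeasurePreserving (fun p : ℝ × (Fin n → ℝ) => slicePoint (n + 1) p.1 p.2) := by
  have h1 : MeasurePreserving (fun p : (Fin n → ℝ) × ℝ => (p.1, p.2 - ∑ l, p.1 l))
      ((volume : Measure (Fin n → ℝ)).prod (volume : Measure ℝ))
      ((volume : Measure (Fin n → ℝ)).prod (volume : Measure ℝ)) := by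
    refine MeasurePreserving.skew_product (f := id) (g := fun (y : Fin n → ℝ) (s : ℝ) => s - ∑ l, y l)
      (MeasurePreserving.id _) (by fun_prop) ?_
    refine ae_of_all _ fun y => ?_
    exact (measurePreserving_sub_right (volume : Measure ℝ) (∑ l, y l)).map_eq
  have h2 := (volume_preserving_piFinSuccAbove (fun _ : Fin (n + 1) => ℝ) (Fin.last n)).symm
  have h3 := h2.comp (Measure.measurePreserving_swap.comp (h1.comp Measure.measurePreserving_swap))
  have heq : (fun p : ℝ × (Fin n → ℝ) => slicePoint (n + 1) p.1 p.2) =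
      (MeasurableEquiv.piFinSuccAbove (fun _ : Fin (n + 1) => ℝ) (Fin.last n)).symm ∘
        Prod.swap ∘ (fun p : (Fin n → ℝ) × ℝ => (p.1, p.2 - ∑ l, p.1 l)) ∘ Prod.swap := by
    funext p
    rw [slicePoint_succ]
    simp [MeasurableEquiv.piFinSuccAbove, Fin.insertNthEquiv]
  rw [heq]
  exact h3

theorem integral_eq_integral_deltaIntegral {n : ℕ} {F : (Fin (n + 1) → ℝ) → ℝ} {φ : ℝ → ℝ}
    (hF : Integrable fun x => φ (∑ l, x l) * F x) :
    ∫ x, φ (∑ l, x l) * F x = ∫ t, φ t * deltaIntegral F t := by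
  have hm := measurePreserving_slicePoint n
  have hint : Integrable (fun p : ℝ × (Fin n → ℝ) => φ p.1 * F (slicePoint (n + 1) p.1 p.2)) := by
    have := hm.integrable_comp_of_integrable hF
    simpa only [Function.comp_def, sum_slicePoint] using this
  have h1 : ∫ x, φ (∑ l, x l) * F x
      = ∫ p : ℝ × (Fin n → ℝ), φ p.1 * F (slicePoint (n + 1) p.1 p.2) := by
    rw [← hm.map_eq, integral_map hm.measurable.aemeasurable (by rw [hm.map_eq]; exact hF.1)]
    simp only [sum_slicePoint]
  rw [h1, Measure.volume_eq_prod, integral_prod _ hint]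
  simp only [integral_const_mul, deltaIntegral_succ]

/-! ### Convergence and continuity of slice integrals off the integers -/

theorem integrable_prod_betaWeight {a b : ℝ} (ha : -1 < a) (hb : 0 < b) (n : ℕ) :
    Integrable fun x : Fin n → ℝ => ∏ l, betaWeight a b (x l) :=
  Integrable.fintype_prod (f := fun _ : Fin n => betaWeight a b) fun _ => integrable_betaWeight ha hb

theorem prod_betaWeight_nonneg {n : ℕ} (a b : ℝ) (x : Fin n → ℝ) :
    0 ≤ ∏ l, betaWeight a b (x l) :=
  Finset.prod_nonneg fun _ _ => betaWeight_nonneg a b _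

theorem mem_Ioo_of_prod_betaWeight_ne_zero {n : ℕ} {a b : ℝ} {x : Fin n → ℝ}
    (h : ∏ l, betaWeight a b (x l) ≠ 0) (l : Fin n) : x l ∈ Set.Ioo (0 : ℝ) 1 :=
  Set.mem_of_indicator_ne_zero (Finset.prod_ne_zero_iff.mp h l (Finset.mem_univ l))

/-- A bound on the cube for a continuous factor bounds the product with the weight. -/
theorem norm_mul_prod_betaWeight_le {n : ℕ} {a b C c : ℝ} {x : Fin n → ℝ}
    (h : x ∈ Set.Icc (0 : Fin n → ℝ) 1 → ‖c‖ ≤ C) :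
    ‖c * ∏ l, betaWeight a b (x l)‖ ≤ C * ∏ l, betaWeight a b (x l) := by
  rw [norm_mul, Real.norm_of_nonneg (prod_betaWeight_nonneg a b x)]
  by_cases h0 : ∏ l, betaWeight a b (x l) = 0
  · simp [h0]
  · have hx := mem_Ioo_of_prod_betaWeight_ne_zero h0
    exact mul_le_mul_of_nonneg_right (h ⟨fun l => (hx l).1.le, fun l => (hx l).2.le⟩)
      (prod_betaWeight_nonneg a b x)

/-- When the eliminated variable carries no singular weight, t enters only through the continuous
`g`. This is bounded for t near t₀ and y in the cube, so the integrable product of the other weights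
dominates. -/
theorem deltaIntegral_last {n : ℕ} {a b : ℝ} (ha : -1 < a) (hb : 0 < b)
    {g : (Fin (n + 1) → ℝ) → ℝ} (hg : Continuous g) :
    (∀ t, DeltaIntegrable (fun x => g x * ∏ l : Fin n, betaWeight a b (x l.castSucc)) t) ∧
    Continuous (deltaIntegral fun x => g x * ∏ l : Fin n, betaWeight a b (x l.castSucc)) := by
  have hG : Continuous fun p : ℝ × (Fin n → ℝ) => g (slicePoint (n + 1) p.1 p.2) :=
    hg.comp (continuous_slicePoint n)
  have hmeas : ∀ t, AEStronglyMeasurable fun y : Fin n → ℝ =>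
      g (slicePoint (n + 1) t y) * ∏ l, betaWeight a b (y l) := fun t =>
    (hG.comp (by fun_prop : Continuous fun y : Fin n → ℝ => (t, y))).aestronglyMeasurable.mul
      (integrable_prod_betaWeight ha hb n).1
  have hbound : ∀ t₀ : ℝ, ∃ C : ℝ, ∀ t ∈ Metric.closedBall t₀ 1, ∀ y : Fin n → ℝ,
      ‖g (slicePoint (n + 1) t y) * ∏ l, betaWeight a b (y l)‖
        ≤ C * ∏ l, betaWeight a b (y l) := by
    intro t₀
    obtain ⟨C, hC⟩ := ((isCompact_closedBall t₀ 1).prod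
      (isCompact_Icc (a := (0 : Fin n → ℝ)) (b := 1))).exists_bound_of_continuousOn hG.continuousOn
    exact ⟨C, fun t ht y => norm_mul_prod_betaWeight_le fun hy => hC (t, y) ⟨ht, hy⟩⟩
  refine ⟨fun t => ?_, continuous_iff_continuousAt.mpr fun t₀ => ?_⟩
  · obtain ⟨C, hC⟩ := hbound t
    rw [deltaIntegrable_succ]
    simp only [slicePoint_castSucc]
    exact Integrable.mono' ((integrable_prod_betaWeight ha hb n).const_mul C) (hmeas t)
      (ae_of_all _ (hC t (Metric.mem_closedBall_self zero_le_one)))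
  · obtain ⟨C, hC⟩ := hbound t₀
    have heq : deltaIntegral (fun x => g x * ∏ l : Fin n, betaWeight a b (x l.castSucc)) =
        fun t => ∫ y : Fin n → ℝ, g (slicePoint (n + 1) t y) * ∏ l, betaWeight a b (y l) := by
      funext t
      rw [deltaIntegral_succ]
      simp only [slicePoint_castSucc]
    rw [heq]
    refine continuousAt_of_dominated (bound := fun y => C * ∏ l, betaWeight a b (y l))
      (Eventually.of_forall hmeas) ?_ ((integrable_prod_betaWeight ha hb n).const_mul C) ?_
    · filter_upwards [Metric.closedBall_mem_nhds t₀ zero_lt_one] with t ht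
      exact ae_of_all _ (hC t ht)
    · refine ae_of_all _ fun y => Continuous.continuousAt ?_
      exact (hG.comp (by fun_prop : Continuous fun t : ℝ => (t, y))).mul continuous_const

theorem deltaIntegral_erase {n : ℕ} {a b : ℝ} (ha : -1 < a) (hb : 0 < b)
    {g : (Fin (n + 1) → ℝ) → ℝ} (hg : Continuous g) (i : Fin (n + 1)) :
    (∀ t, DeltaIntegrable
      (fun x => g x * ∏ l, if l = i then 1 else betaWeight a b (x l)) t) ∧
    Continuous (deltaIntegral fun x => g x * ∏ l, if l = i then 1 else betaWeight a b (x l)) := by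
  set F : (Fin (n + 1) → ℝ) → ℝ := fun x => g x * ∏ l, if l = i then 1 else betaWeight a b (x l)
    with hF
  have key : (fun x => F (x ∘ Equiv.swap i (Fin.last n))) = fun x =>
      g (x ∘ Equiv.swap i (Fin.last n)) * ∏ l : Fin n, betaWeight a b (x l.castSucc) := by
    funext x
    rw [hF]
    simp only
    congr 1
    rw [← Equiv.prod_comp (Equiv.swap i (Fin.last n)), Fin.prod_univ_castSucc]
    simp [Equiv.swap_apply_eq_iff, (Fin.castSucc_lt_last _).ne]
  have hg' : Continuous fun x : Fin (n + 1) → ℝ => g (x ∘ Equiv.swap i (Fin.last n)) :=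
    hg.comp (by fun_prop)
  obtain ⟨h1, h2⟩ := deltaIntegral_last ha hb hg'
  rw [← key] at h1 h2
  refine ⟨fun t => (deltaIntegrable_comp_swap F i t).mp (h1 t), ?_⟩
  have : deltaIntegral (fun x => F (x ∘ Equiv.swap i (Fin.last n))) = deltaIntegral F :=
    funext fun t => deltaIntegral_comp_swap F i t
  rwa [this] at h2

/-- A continuous cutoff that vanishes near and outside of `{0, 1}` and equals `1` on
`[2δ, 1 - 2δ]`. -/
def cutoff (δ s : ℝ) : ℝ := max 0 (min 1 ((min s (1 - s) - δ) / δ))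

theorem continuous_cutoff (δ : ℝ) : Continuous (cutoff δ) := by
  unfold cutoff; fun_prop

theorem cutoff_eq_zero {δ s : ℝ} (hδ : 0 < δ) (h : min s (1 - s) ≤ δ) : cutoff δ s = 0 := by
  unfold cutoff
  have : (min s (1 - s) - δ) / δ ≤ 0 := div_nonpos_of_nonpos_of_nonneg (by linarith) hδ.le
  exact max_eq_left ((min_le_right _ _).trans this)

theorem cutoff_eq_one {δ s : ℝ} (hδ : 0 < δ) (h : 2 * δ ≤ min s (1 - s)) : cutoff δ s = 1 := by
  unfold cutoff
  have : 1 ≤ (min s (1 - s) - δ) / δ := by rw [le_div_iff₀ hδ]; linarith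
  rw [min_eq_left this]; exact max_eq_right zero_le_one

theorem continuous_cutoff_mul_betaWeight (a b : ℝ) {δ : ℝ} (hδ : 0 < δ) :
    Continuous fun s => cutoff δ s * betaWeight a b s := by
  refine continuous_iff_continuousAt.mpr fun s => ?_
  by_cases hs : s ∈ Set.Ioo (0 : ℝ) 1
  · refine (continuous_cutoff δ).continuousAt.mul ?_
    have h1 : ContinuousAt (fun s : ℝ => s ^ a * (1 - s) ^ (b - 1)) s :=
      (Real.continuousAt_rpow_const _ _ (Or.inl hs.1.ne')).mul
        (ContinuousAt.rpow_const (by fun_prop) (Or.inl (by linarith [hs.2])))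
    refine h1.congr ?_
    filter_upwards [isOpen_Ioo.mem_nhds hs] with u hu
    rw [betaWeight, Set.indicator_of_mem hu]
  · have h1 : min s (1 - s) < δ := by
      refine lt_of_le_of_lt ?_ hδ
      by_contra h
      rw [not_le, lt_min_iff] at h
      exact hs ⟨h.1, by linarith [h.2]⟩
    have h2 : ∀ᶠ u in 𝓝 s, min u (1 - u) < δ :=
      (by fun_prop : Continuous fun u : ℝ => min u (1 - u)).continuousAt.eventually_lt_const h1
    refine (continuousAt_const (y := (0 : ℝ))).congr ?_
    filter_upwards [h2] with u hu
    rw [cutoff_eq_zero hδ hu.le, zero_mul]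

/-- If no factor vanishes, every coordinate is within 2δ of 0 or 1. The sum is then within 2δn of
the number of coordinates near 1, an integer between 0 and n. -/
theorem prod_one_sub_cutoff_eq_zero {n : ℕ} {δ : ℝ} (hδ : 0 < δ) {x : Fin n → ℝ}
    (hx : ∀ l, x l ∈ Set.Ioo (0 : ℝ) 1) (h : ∀ m : ℕ, m ≤ n → 2 * δ * n < |∑ l, x l - m|) :
    ∏ l, (1 - cutoff δ (x l)) = 0 := by
  classical
  by_contra h0
  have h1 : ∀ l, min (x l) (1 - x l) < 2 * δ := by
    intro l
    by_contra hl
    exact Finset.prod_ne_zero_iff.mp h0 l (Finset.mem_univ l)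
      (by rw [cutoff_eq_one hδ (not_lt.mp hl), sub_self])
  let S : Finset (Fin n) := Finset.univ.filter fun l => 2 * δ ≤ x l
  have hS : S.card ≤ n := by simpa using S.card_le_univ
  refine absurd (h S.card hS) (not_lt.mpr ?_)
  have h2 : ((S.card : ℕ) : ℝ) = ∑ l, if 2 * δ ≤ x l then (1 : ℝ) else 0 := by
    rw [Finset.sum_boole]
  rw [h2, ← Finset.sum_sub_distrib]
  refine (Finset.abs_sum_le_sum_abs _ _).trans ?_
  have h3 : ∀ l ∈ Finset.univ, |x l - if 2 * δ ≤ x l then (1 : ℝ) else 0| ≤ 2 * δ := by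
    intro l _
    have h4 := hx l
    have h5 := h1 l
    rw [min_lt_iff] at h5
    split_ifs with h6
    · rw [abs_le]
      constructor
      · rcases h5 with h5 | h5 <;> linarith
      · linarith [h4.2]
    · rw [abs_le]
      constructor <;> linarith [h4.1]
  refine (Finset.sum_le_sum h3).trans ?_
  simp [mul_comm]

theorem exists_pos_le_dist_nat {n : ℕ} {t : ℝ} (ht : ∀ m : ℕ, m ≤ n → t ≠ m) :
    ∃ r : ℝ, 0 < r ∧ ∀ m : ℕ, m ≤ n → r ≤ |t - m| := by
  obtain ⟨m, hm, hmin⟩ := (Finset.range (n + 1)).exists_min_image (fun m : ℕ => |t - m|) ⟨0, by simp⟩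
  refine ⟨|t - m|, abs_pos.mpr (sub_ne_zero.mpr (ht m ?_)), fun k hk => hmin k ?_⟩
  · exact Nat.lt_succ_iff.mp (Finset.mem_range.mp hm)
  · exact Finset.mem_range.mpr (Nat.lt_succ_of_le hk)

/-- Off the integers `0, …, N`, the slices of a continuous function times the product of Jacobi
weights are integrable, with an integral that is continuous in `t`. -/
theorem deltaIntegrable_and_continuousAt {n : ℕ} {a b : ℝ} (ha : -1 < a) (hb : 0 < b)
    {f : (Fin (n + 1) → ℝ) → ℝ} (hf : Continuous f) {t₀ : ℝ}
    (ht₀ : ∀ m : ℕ, m ≤ n + 1 → t₀ ≠ m) :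
    DeltaIntegrable (fun x => f x * ∏ l, betaWeight a b (x l)) t₀ ∧
    ContinuousAt (deltaIntegral fun x => f x * ∏ l, betaWeight a b (x l)) t₀ := by
  obtain ⟨r, hr, hrt⟩ := exists_pos_le_dist_nat ht₀
  have hn : (0 : ℝ) < ((n + 1 : ℕ) : ℝ) := by positivity
  -- With this δ the tolerance 2δ(n + 1) equals r/2; the other r/2 of the distance from t₀ to the
  -- integers is left for moving t.
  set δ : ℝ := r / (4 * ((n + 1 : ℕ) : ℝ)) with hδ_def
  have hδ : 0 < δ := by positivity
  have hδ2 : 2 * δ * ((n + 1 : ℕ) : ℝ) = r / 2 := by rw [hδ_def]; field_simp; norm_num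
  -- Partition of unity: the i-th piece is cut off near the endpoints of x_i, so the weight of x_i
  -- becomes a continuous factor and x_i can be eliminated. The pieces add up to 1 - ∏ (1 - cutoff),
  -- which is 1 on slices near t₀.
  let g : Fin (n + 1) → (Fin (n + 1) → ℝ) → ℝ := fun i x =>
    f x * (cutoff δ (x i) * betaWeight a b (x i)) *
      ∏ j ∈ Finset.univ.filter (· < i), (1 - cutoff δ (x j))
  have hg : ∀ i, Continuous (g i) := by
    intro i
    refine (hf.mul ((continuous_cutoff_mul_betaWeight a b hδ).comp (continuous_apply i))).mul ?_
    exact continuous_finsetProd _ fun j _ =>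
      continuous_const.sub ((continuous_cutoff δ).comp (continuous_apply j))
  let F : Fin (n + 1) → (Fin (n + 1) → ℝ) → ℝ := fun i x =>
    g i x * ∏ l, if l = i then 1 else betaWeight a b (x l)
  have hI : ∀ i t, DeltaIntegrable (F i) t := fun i => (deltaIntegral_erase ha hb (hg i) i).1
  have hC : ∀ i, Continuous (deltaIntegral (F i)) := fun i => (deltaIntegral_erase ha hb (hg i) i).2
  have hFi : ∀ i x, F i x = (f x * ∏ l, betaWeight a b (x l)) *
      (cutoff δ (x i) * ∏ j ∈ Finset.univ.filter (· < i), (1 - cutoff δ (x j))) := by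
    intro i x
    have : ∏ l, betaWeight a b (x l) =
        betaWeight a b (x i) * ∏ l, if l = i then 1 else betaWeight a b (x l) := by
      rw [← Finset.mul_prod_erase _ _ (Finset.mem_univ i),
        ← Finset.mul_prod_erase _ (fun l => if l = i then 1 else betaWeight a b (x l))
          (Finset.mem_univ i)]
      simp only [if_true, one_mul]
      congr 1
      exact Finset.prod_congr rfl fun l hl => by rw [if_neg (Finset.ne_of_mem_erase hl)]
    simp only [F, g]
    rw [this]
    ring
  have hsum : ∀ t ∈ Metric.ball t₀ (r / 2), ∀ x : Fin (n + 1) → ℝ, ∑ l, x l = t →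
      f x * ∏ l, betaWeight a b (x l) = ∑ i, F i x := by
    intro t ht x hx
    simp only [hFi]
    rw [← Finset.mul_sum]
    by_cases h0 : ∏ l, betaWeight a b (x l) = 0
    · simp [h0]
    have hz : ∏ l, (1 - cutoff δ (x l)) = 0 := by
      refine prod_one_sub_cutoff_eq_zero hδ (mem_Ioo_of_prod_betaWeight_ne_zero h0) fun m hm => ?_
      rw [hδ2, hx]
      have h1 := hrt m hm
      have h2 : |t - t₀| < r / 2 := ht
      have h3 : |t₀ - m| ≤ |t₀ - t| + |t - m| := abs_sub_le _ _ _
      rw [abs_sub_comm t₀ t] at h3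
      linarith
    have h1 := Finset.prod_one_sub_ordered Finset.univ fun l => cutoff δ (x l)
    rw [hz] at h1
    have h2 : ∑ i, cutoff δ (x i) * ∏ j ∈ Finset.univ.filter (· < i), (1 - cutoff δ (x j)) = 1 := by
      linarith
    rw [h2, mul_one]
  have hslice : ∀ t ∈ Metric.ball t₀ (r / 2),
      (fun y : Fin n → ℝ => f (slicePoint (n + 1) t y) *
        ∏ l, betaWeight a b (slicePoint (n + 1) t y l)) =
      fun y => ∑ i, F i (slicePoint (n + 1) t y) := fun t ht =>
    funext fun y => hsum t ht _ (sum_slicePoint t y)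
  constructor
  · rw [deltaIntegrable_succ, hslice t₀ (Metric.mem_ball_self (by positivity))]
    exact integrable_finsetSum _ fun i _ => hI i t₀
  · have h1 : ContinuousAt (fun t => ∑ i, deltaIntegral (F i) t) t₀ :=
      (continuous_finsetSum _ fun i _ => hC i).continuousAt
    refine h1.congr ?_
    filter_upwards [Metric.ball_mem_nhds t₀ (by positivity : 0 < r / 2)] with t ht
    rw [deltaIntegral_succ, hslice t ht, integral_finsetSum _ fun i _ => hI i t]
    rfl

/-! ### Integration by parts against the Jacobi weight -/

theorem integrable_mul_prod_betaWeight {n : ℕ} {a b : ℝ} (ha : -1 < a) (hb : 0 < b)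
    {f : (Fin n → ℝ) → ℝ} (hf : Continuous f) :
    Integrable fun x => f x * ∏ l, betaWeight a b (x l) := by
  obtain ⟨C, hC⟩ := (isCompact_Icc (a := (0 : Fin n → ℝ)) (b := 1)).exists_bound_of_continuousOn
    hf.continuousOn
  exact Integrable.mono' ((integrable_prod_betaWeight ha hb n).const_mul C)
    (hf.aestronglyMeasurable.mul (integrable_prod_betaWeight ha hb n).1)
    (ae_of_all _ fun x => norm_mul_prod_betaWeight_le (hC x))

theorem integrable_mul_betaWeight {a b : ℝ} (ha : -1 < a) (hb : 0 < b)
    {f : ℝ → ℝ} (hf : Continuous f) : Integrable fun s => f s * betaWeight a b s := by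
  obtain ⟨C, hC⟩ := (isCompact_Icc (a := (0 : ℝ)) (b := 1)).exists_bound_of_continuousOn
    hf.continuousOn
  refine Integrable.mono' ((integrable_betaWeight ha hb).const_mul C)
    (hf.aestronglyMeasurable.mul (integrable_betaWeight ha hb).1) (ae_of_all _ fun s => ?_)
  rw [norm_mul, Real.norm_of_nonneg (betaWeight_nonneg a b s)]
  by_cases hs : s ∈ Set.Ioo (0 : ℝ) 1
  · exact mul_le_mul_of_nonneg_right (hC s ⟨hs.1.le, hs.2.le⟩) (betaWeight_nonneg a b s)
  · simp [betaWeight, Set.indicator_of_notMem hs]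

/-- Integration by parts against the Jacobi weight: the divergence of `h(s) s (1 - s)` with
respect to the weight has integral zero. -/
theorem integral_betaWeight_divergence {a b : ℝ} (ha : -1 < a) (hb : 0 < b) {h h' : ℝ → ℝ}
    (hd : ∀ s, HasDerivAt h (h' s) s) (hc : Continuous h') :
    ∫ s, (h' s * (s * (1 - s)) + h s * ((a + 1) * (1 - s) - b * s)) * betaWeight a b s = 0 := by
  have hh : Continuous h := continuous_iff_continuousAt.mpr fun s => (hd s).continuousAt
  set g : ℝ → ℝ := fun s => (h' s * (s * (1 - s)) + h s * ((a + 1) * (1 - s) - b * s)) *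
    (s ^ a * (1 - s) ^ (b - 1)) with hg
  have h1 : (fun s => (h' s * (s * (1 - s)) + h s * ((a + 1) * (1 - s) - b * s)) *
      betaWeight a b s) = (Set.Ioo (0 : ℝ) 1).indicator g := by
    funext s
    rw [betaWeight, Set.indicator_apply, Set.indicator_apply]
    split_ifs <;> simp [hg]
  have hint : Integrable ((Set.Ioo (0 : ℝ) 1).indicator g) := by
    rw [← h1]
    exact integrable_mul_betaWeight ha hb (by fun_prop)
  rw [integrable_indicator_iff measurableSet_Ioo, ← integrableOn_Ioc_iff_integrableOn_Ioo,
    ← intervalIntegrable_iff_integrableOn_Ioc_of_le zero_le_one] at hint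
  rw [h1, integral_indicator measurableSet_Ioo, ← integral_Ioc_eq_integral_Ioo,
    ← intervalIntegral.integral_of_le zero_le_one]
  have ha1 : 0 < a + 1 := by linarith
  have hcont : Continuous fun s : ℝ => h s * (s ^ (a + 1) * (1 - s) ^ b) :=
    hh.mul ((Real.continuous_rpow_const ha1.le).mul
      ((Real.continuous_rpow_const hb.le).comp (by fun_prop : Continuous fun s : ℝ => 1 - s)))
  -- The primitive h(s) s^(a+1) (1-s)^b is continuous on [0, 1] and vanishes at both ends because a
  -- + 1 > 0 and b > 0. Its derivative may be singular there, but is integrable.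
  have := intervalIntegral.integral_eq_sub_of_hasDerivAt_of_le zero_le_one hcont.continuousOn
    (f' := g) (fun s hs => ?_) hint
  · rw [this]
    simp [Real.zero_rpow ha1.ne', Real.zero_rpow hb.ne']
  · have hs0 : 0 < s := hs.1
    have hs1 : 0 < 1 - s := by linarith [hs.2]
    have d1 : HasDerivAt (fun s : ℝ => s ^ (a + 1)) ((a + 1) * s ^ a) s := by
      simpa using Real.hasDerivAt_rpow_const (p := a + 1) (Or.inl hs0.ne')
    have d2 : HasDerivAt (fun s : ℝ => (1 - s) ^ b) (-1 * b * (1 - s) ^ (b - 1)) s :=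
      ((hasDerivAt_id s).const_sub 1).rpow_const (Or.inl hs1.ne')
    refine ((hd s).mul (d1.mul d2)).congr_deriv ?_
    have e1 : s ^ (a + 1) = s ^ a * s := by rw [Real.rpow_add_one hs0.ne']
    have e2 : (1 - s) ^ b = (1 - s) ^ (b - 1) * (1 - s) := by
      rw [← Real.rpow_add_one hs1.ne', sub_add_cancel]
    rw [hg]
    simp only [e1, e2, Pi.mul_apply]
    ring

theorem integral_prod_betaWeight_divergence {n : ℕ} {a b : ℝ} (ha : -1 < a) (hb : 0 < b)
    (i : Fin (n + 1)) {h h' : (Fin (n + 1) → ℝ) → ℝ} (hh : Continuous h) (hh' : Continuous h')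
    (hd : ∀ x s, HasDerivAt (fun u => h (Function.update x i u)) (h' (Function.update x i s)) s) :
    ∫ x, (h' x * (x i * (1 - x i)) + h x * ((a + 1) * (1 - x i) - b * x i)) *
      ∏ l, betaWeight a b (x l) = 0 := by
  set F : (Fin (n + 1) → ℝ) → ℝ := fun x =>
    (h' x * (x i * (1 - x i)) + h x * ((a + 1) * (1 - x i) - b * x i)) *
      ∏ l, betaWeight a b (x l) with hF
  have hint : Integrable F := integrable_mul_prod_betaWeight ha hb (by fun_prop)
  have hm := (volume_preserving_piFinSuccAbove (fun _ : Fin (n + 1) => ℝ) i).symm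
  have hint2 := hm.integrable_comp_of_integrable hint
  have h1 := hm.integral_comp' F
  rw [← h1]
  -- Fubini with x_i as the inner variable: the inner integral already vanishes, by the one-variable
  -- identity.
  refine (integral_prod_symm _ hint2).trans ?_
  refine integral_eq_zero_of_ae (ae_of_all _ fun y => ?_)
  have hup : ∀ s, (MeasurableEquiv.piFinSuccAbove (fun _ : Fin (n + 1) => ℝ) i).symm (s, y) =
      Function.update (i.insertNth (α := fun _ => ℝ) 0 y) i s := by
    intro s
    rw [Fin.update_insertNth]
    rfl
  set x₀ := i.insertNth (α := fun _ => ℝ) 0 y with hx₀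
  have hprod : ∀ s, ∏ l, betaWeight a b (Function.update x₀ i s l) =
      betaWeight a b s * ∏ l, betaWeight a b (y l) := by
    intro s
    rw [hx₀, Fin.update_insertNth, Fin.prod_univ_succAbove _ i]
    simp
  simp only [Function.comp_apply, hup, hF, hprod, Function.update_self, Pi.zero_apply]
  simp only [← mul_assoc]
  rw [integral_mul_const]
  simp only [mul_assoc]
  rw [integral_betaWeight_divergence ha hb (hd x₀), zero_mul]
  exact hh'.comp (by fun_prop)

/-! ### The regularized interaction -/

/-- The regularized Vandermonde factor `∏_{j ≠ k} ((x_j - x_k)² + e)^(β/4)`. -/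
def regVandermonde {n : ℕ} (β e : ℝ) (x : Fin n → ℝ) : ℝ :=
  ∏ p ∈ (Finset.univ : Finset (Fin n)).offDiag, ((x p.1 - x p.2) ^ 2 + e) ^ (β / 4)

theorem continuous_regVandermonde {n : ℕ} {β : ℝ} (hβ : 0 ≤ β) :
    Continuous fun p : ℝ × (Fin n → ℝ) => regVandermonde β p.1 p.2 := by
  unfold regVandermonde
  refine continuous_finsetProd _ fun p _ => ?_
  exact (Real.continuous_rpow_const (by positivity)).comp (by fun_prop)

theorem regVandermonde_nonneg {n : ℕ} {β e : ℝ} (he : 0 ≤ e) (x : Fin n → ℝ) :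
    0 ≤ regVandermonde β e x :=
  Finset.prod_nonneg fun _ _ => Real.rpow_nonneg (by positivity) _

theorem regVandermonde_mono {n : ℕ} {β e e' : ℝ} (hβ : 0 ≤ β) (he : 0 ≤ e) (h : e ≤ e')
    (x : Fin n → ℝ) : regVandermonde β e x ≤ regVandermonde β e' x := by
  refine Finset.prod_le_prod (fun _ _ => Real.rpow_nonneg (by positivity) _) fun p _ => ?_
  exact Real.rpow_le_rpow (by positivity) (by linarith) (by positivity)

theorem regVandermonde_zero_of_eq {n : ℕ} {β : ℝ} (hβ : 0 < β) {x : Fin n → ℝ} {i k : Fin n}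
    (hik : i ≠ k) (h : x i = x k) : regVandermonde β 0 x = 0 := by
  refine Finset.prod_eq_zero (i := (i, k)) (by simpa using hik) ?_
  simp only [h, sub_self]
  simp [Real.zero_rpow (by positivity : β / 4 ≠ 0)]

/-- Logarithmic differentiation. The product runs over ordered pairs, so x_i meets each other
variable twice; together with the 2 from the square this turns the exponent β/4 into the factor β.
-/
theorem hasDerivAt_regVandermonde {n : ℕ} (β : ℝ) {e : ℝ} (he : 0 < e) (i : Fin n)
    (x : Fin n → ℝ) (s : ℝ) :
    HasDerivAt (fun u => regVandermonde β e (Function.update x i u))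
      ((fun y : Fin n → ℝ => regVandermonde β e y *
        (β * ∑ k, (y i - y k) / ((y i - y k) ^ 2 + e))) (Function.update x i s)) s := by
  have hpos : ∀ r : ℝ, 0 < r ^ 2 + e := fun r => by positivity
  have hV : ∀ y : Fin n → ℝ, regVandermonde β e y =
      Real.exp (β / 4 * ∑ p ∈ (Finset.univ : Finset (Fin n)).offDiag,
        Real.log ((y p.1 - y p.2) ^ 2 + e)) := by
    intro y
    rw [regVandermonde, Finset.mul_sum, Real.exp_sum]
    refine Finset.prod_congr rfl fun p _ => ?_
    rw [Real.rpow_def_of_pos (hpos _), mul_comm]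
  have hu : ∀ j, HasDerivAt (fun u => Function.update x i u j) ((Pi.single i 1 : Fin n → ℝ) j) s :=
    hasDerivAt_pi.mp (hasDerivAt_update x i s)
  set y := Function.update x i s with hy
  have hlog : ∀ p : Fin n × Fin n,
      HasDerivAt (fun u => Real.log ((Function.update x i u p.1 - Function.update x i u p.2) ^ 2 + e))
        (2 * ((y p.1 - y p.2) / ((y p.1 - y p.2) ^ 2 + e)) *
          ((Pi.single i 1 : Fin n → ℝ) p.1 - (Pi.single i 1 : Fin n → ℝ) p.2)) s := by
    intro p
    refine (((((hu p.1).fun_sub (hu p.2)).fun_pow 2).add_const e).log (hpos _).ne').congr_deriv ?_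
    simp only [← hy]
    ring
  have hsum := ((HasDerivAt.fun_sum fun p (_ : p ∈ (Finset.univ : Finset (Fin n)).offDiag) =>
    hlog p).const_mul (β / 4)).exp
  simp only [hV]
  refine hsum.congr_deriv ?_
  rw [← hy]
  congr 1
  have hoff : ∀ f : Fin n × Fin n → ℝ, (∀ j, f (j, j) = 0) →
      ∑ p ∈ (Finset.univ : Finset (Fin n)).offDiag, f p = ∑ j, ∑ k, f (j, k) := by
    intro f hf
    rw [← Fintype.sum_prod_type']
    refine Finset.sum_subset (Finset.subset_univ _) fun p _ hp => ?_
    have : p.1 = p.2 := by simpa using hp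
    obtain ⟨j, k⟩ := p
    simp only at this
    rw [this]; exact hf k
  rw [hoff _ fun j => by simp]
  simp only [mul_sub, Finset.sum_sub_distrib, Pi.single_apply, mul_ite, mul_one, mul_zero,
    Finset.sum_ite_irrel, Finset.sum_ite_eq', Finset.mem_univ, if_true, Finset.sum_const_zero]
  have hanti : ∑ j, 2 * ((y j - y i) / ((y j - y i) ^ 2 + e)) =
      - ∑ j, 2 * ((y i - y j) / ((y i - y j) ^ 2 + e)) := by
    rw [← Finset.sum_neg_distrib]
    refine Finset.sum_congr rfl fun j _ => ?_
    rw [← neg_sub (y i) (y j), neg_sq]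
    ring
  rw [hanti]
  rw [← Finset.mul_sum]
  ring

/-! ### Polynomial identities for the vector field -/

open Polynomial

/-- The linear polynomial `s + (1 - s) X`. -/
def linFactor (s : ℝ) : ℝ[X] := C s + X * C (1 - s)

/-- The polynomial `∏_{l ∈ S} (x_l + (1 - x_l) X)`; for `S` the set of all indices, its `j`-th
coefficient is the sum over the sets `J` of `j` indices of
`∏_{l ∈ J} (1 - x_l) ∏_{l ∉ J} x_l`. -/
def linProd {n : ℕ} (S : Finset (Fin n)) (x : Fin n → ℝ) : ℝ[X] := ∏ l ∈ S, linFactor (x l)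

theorem linProd_erase {n : ℕ} {S : Finset (Fin n)} {i : Fin n} (hi : i ∈ S) (x : Fin n → ℝ) :
    linProd S x = linFactor (x i) * linProd (S.erase i) x :=
  (Finset.mul_prod_erase S _ hi).symm

theorem derivative_linProd {n : ℕ} (S : Finset (Fin n)) (x : Fin n → ℝ) :
    derivative (linProd S x) = ∑ i ∈ S, C (1 - x i) * linProd (S.erase i) x := by
  rw [linProd, derivative_prod_finset]
  refine Finset.sum_congr rfl fun i _ => ?_
  have : derivative (linFactor (x i)) = C (1 - x i) := by
    rw [linFactor, derivative_add, derivative_C, derivative_mul, derivative_X, derivative_C]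
    ring
  rw [this, mul_comm]
  rfl

theorem derivative_derivative_linProd {n : ℕ} (S : Finset (Fin n)) (x : Fin n → ℝ) :
    derivative (derivative (linProd S x)) =
      ∑ i ∈ S, ∑ k ∈ S.erase i, C (1 - x i) * C (1 - x k) * linProd ((S.erase i).erase k) x := by
  rw [derivative_linProd, derivative_sum]
  refine Finset.sum_congr rfl fun i _ => ?_
  rw [derivative_mul, derivative_C, derivative_linProd, zero_mul, zero_add, Finset.mul_sum]
  simp only [mul_assoc]

/-- Termwise, x(1-x)(X-1) = (x-1)(x + (1-x)X) + X(1-x). The operator X d/dX multiplies the j-th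
coefficient by j, which is why the left-hand side of the differential equation is diagonal. -/
theorem sum_vectorField {n : ℕ} (x : Fin n → ℝ) :
    ∑ i, C (x i * (1 - x i)) * ((X - 1) * linProd (Finset.univ.erase i) x) =
      C (∑ l, x l - n) * linProd Finset.univ x + X * derivative (linProd Finset.univ x) := by
  have h : (C (∑ l, x l - n) : ℝ[X]) = ∑ i, C (x i - 1) := by
    rw [← map_sum, Finset.sum_sub_distrib]; simp
  rw [h, derivative_linProd, Finset.sum_mul, Finset.mul_sum, ← Finset.sum_add_distrib]
  refine Finset.sum_congr rfl fun i hi => ?_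
  rw [linProd_erase hi]
  simp only [linFactor, C_mul, C_sub, C_1]
  ring

/-- Both sums reduce to Q and Q': ∑ (1 - x_i) Q_{≠i} = Q', and x_i Q_{≠i} = Q - X (1 - x_i) Q_{≠i},
where Q_{≠i} omits the factor i. -/
theorem sum_weightTerm {n : ℕ} (a b : ℝ) (x : Fin n → ℝ) :
    ∑ i, C ((a + 1) * (1 - x i) - b * x i) * ((X - 1) * linProd (Finset.univ.erase i) x) =
      (X - 1) * (C (a + 1) * derivative (linProd Finset.univ x) -
        C b * (C (n : ℝ) * linProd Finset.univ x - X * derivative (linProd Finset.univ x))) := by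
  have h : (C (n : ℝ) : ℝ[X]) = ∑ _i : Fin n, 1 := by simp
  rw [h, derivative_linProd, Finset.sum_mul, Finset.mul_sum, Finset.mul_sum,
    ← Finset.sum_sub_distrib, Finset.mul_sum, ← Finset.sum_sub_distrib, Finset.mul_sum]
  refine Finset.sum_congr rfl fun i hi => ?_
  rw [linProd_erase hi]
  simp only [linFactor, C_mul, C_sub, C_1]
  ring

/-- The polynomial which the interaction of the variables `i` and `k` contributes to the
divergence. -/
def pairTerm {n : ℕ} (i k : Fin n) (x : Fin n → ℝ) : ℝ[X] :=
  (X - 1) * ((X * C ((1 - x i) * (1 - x k)) - C (x i * x k)) *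
    linProd ((Finset.univ.erase i).erase k) x)

/-- The difference of two components is divisible by x_i - x_k; this cancels the singularity of the
logarithmic derivative of |x_i - x_k|^β. -/
theorem vectorField_sub_vectorField {n : ℕ} {i k : Fin n} (hik : k ≠ i) (x : Fin n → ℝ) :
    C (x i * (1 - x i)) * ((X - 1) * linProd (Finset.univ.erase i) x) -
      C (x k * (1 - x k)) * ((X - 1) * linProd (Finset.univ.erase k) x) =
      C (x i - x k) * pairTerm i k x := by
  rw [pairTerm, linProd_erase (S := Finset.univ.erase i) (i := k) (by simpa using hik),
    linProd_erase (S := Finset.univ.erase k) (i := i) (by simpa using hik.symm),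
    Finset.erase_right_comm (a := k)]
  simp only [linFactor, C_mul, C_sub, C_1]
  ring

theorem sum_pairTerm {n : ℕ} (x : Fin n → ℝ) :
    ∑ i, ∑ k ∈ Finset.univ.erase i, pairTerm i k x =
      (X - 1) * ((X - X ^ 2) * derivative (derivative (linProd Finset.univ x)) +
        C (2 * ((n : ℝ) - 1)) * (X * derivative (linProd Finset.univ x)) -
        C ((n : ℝ) * (n - 1)) * linProd Finset.univ x) := by
  set Q := linProd Finset.univ x with hQ
  set D : Fin n → ℝ[X] := fun i => C (1 - x i) * linProd (Finset.univ.erase i) x with hD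
  set E : Fin n → Fin n → ℝ[X] := fun i k =>
    C (1 - x i) * C (1 - x k) * linProd ((Finset.univ.erase i).erase k) x with hE
  have hcard : ∀ i : Fin n, (((Finset.univ.erase i).card : ℕ) : ℝ[X]) = C ((n : ℝ) - 1) := by
    intro i
    have hn : 1 ≤ n := i.pos
    rw [Finset.card_erase_of_mem (Finset.mem_univ i), Finset.card_univ, Fintype.card_fin,
      Nat.cast_sub hn]
    simp
  -- Each pair term is written through summands of Q'' (`E`), summands of Q' (`D`), and Q itself, so
  -- that the double sum can be evaluated.
  have h1 : ∀ i, ∀ k ∈ Finset.univ.erase i, pairTerm i k x =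
      (X - 1) * ((X - X ^ 2) * E i k + X * D i + X * D k - Q) := by
    intro i k hk
    have hki : k ≠ i := Finset.ne_of_mem_erase hk
    have e1 : linProd (Finset.univ.erase i) x =
        linFactor (x k) * linProd ((Finset.univ.erase i).erase k) x := linProd_erase hk x
    have e2 : linProd (Finset.univ.erase k) x =
        linFactor (x i) * linProd ((Finset.univ.erase i).erase k) x := by
      rw [Finset.erase_right_comm]
      exact linProd_erase (by simpa using hki.symm) x
    have e3 : Q = linFactor (x i) * linProd (Finset.univ.erase i) x :=
      linProd_erase (Finset.mem_univ i) x
    rw [e3]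
    simp only [hD, hE, pairTerm]
    rw [e2, e1]
    simp only [linFactor, C_mul, C_sub, C_1]
    ring
  have hD' : derivative Q = ∑ i, D i := derivative_linProd _ _
  have hE' : derivative (derivative Q) = ∑ i, ∑ k ∈ Finset.univ.erase i, E i k :=
    derivative_derivative_linProd _ _
  have hDk : ∑ i, ∑ k ∈ Finset.univ.erase i, D k = C ((n : ℝ) - 1) * ∑ i, D i := by
    have : ∀ i, ∑ k ∈ Finset.univ.erase i, D k = ∑ k, D k - D i := fun i => by
      rw [← Finset.add_sum_erase _ _ (Finset.mem_univ i)]; ring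
    simp only [this, Finset.sum_sub_distrib, Finset.sum_const, Finset.card_univ, Fintype.card_fin,
      nsmul_eq_mul, C_sub, C_1, map_natCast]
    ring
  have hDi : ∑ i, ∑ _k ∈ Finset.univ.erase i, D i = C ((n : ℝ) - 1) * ∑ i, D i := by
    simp only [Finset.sum_const, nsmul_eq_mul, hcard, Finset.mul_sum]
  have hQi : ∑ i : Fin n, ∑ _k ∈ Finset.univ.erase i, Q = C ((n : ℝ) * (n - 1)) * Q := by
    simp only [Finset.sum_const, nsmul_eq_mul, hcard, Finset.card_univ, Fintype.card_fin, C_mul,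
      map_natCast]
    ring
  rw [Finset.sum_congr rfl fun i _ => Finset.sum_congr rfl (h1 i)]
  simp only [← Finset.mul_sum, Finset.sum_sub_distrib, Finset.sum_add_distrib]
  rw [hDi, hDk, hQi, ← hE', ← hD']
  simp only [C_mul, map_ofNat]
  ring

/-! ### Continuity of coefficients and the three-term form of the divergence -/

/-- All coefficients of the polynomial depend continuously on the parameter. -/
def ContinuousCoeff {α : Type*} [TopologicalSpace α] (P : α → ℝ[X]) : Prop :=
  ∀ j, Continuous fun x => (P x).coeff j

theorem ContinuousCoeff.mul {α : Type*} [TopologicalSpace α] {P Q : α → ℝ[X]}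
    (hP : ContinuousCoeff P) (hQ : ContinuousCoeff Q) : ContinuousCoeff fun x => P x * Q x := by
  intro j
  simp only [coeff_mul]
  exact continuous_finsetSum _ fun p _ => (hP p.1).mul (hQ p.2)

theorem ContinuousCoeff.add {α : Type*} [TopologicalSpace α] {P Q : α → ℝ[X]}
    (hP : ContinuousCoeff P) (hQ : ContinuousCoeff Q) : ContinuousCoeff fun x => P x + Q x := by
  intro j
  simp only [coeff_add]
  exact (hP j).add (hQ j)

theorem ContinuousCoeff.sub {α : Type*} [TopologicalSpace α] {P Q : α → ℝ[X]}
    (hP : ContinuousCoeff P) (hQ : ContinuousCoeff Q) : ContinuousCoeff fun x => P x - Q x := by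
  intro j
  simp only [coeff_sub]
  exact (hP j).sub (hQ j)

theorem continuousCoeff_const {α : Type*} [TopologicalSpace α] (P : ℝ[X]) :
    ContinuousCoeff fun _ : α => P := fun _ => continuous_const

theorem continuousCoeff_C {α : Type*} [TopologicalSpace α] {f : α → ℝ} (hf : Continuous f) :
    ContinuousCoeff fun x => C (f x) := by
  intro j
  simp only [coeff_C]
  split_ifs
  · exact hf
  · exact continuous_const

theorem continuousCoeff_linProd {n : ℕ} (S : Finset (Fin n)) : ContinuousCoeff (linProd S) := by
  classical
  induction S using Finset.induction_on with
  | empty => exact continuousCoeff_const (α := Fin n → ℝ) 1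
  | insert i S hi ih =>
    have h : linProd (insert i S) = fun x => linFactor (x i) * linProd S x :=
      funext fun x => Finset.prod_insert hi
    rw [h]
    refine ContinuousCoeff.mul ?_ ih
    exact (continuousCoeff_C (by fun_prop)).add
      ((continuousCoeff_const X).mul (continuousCoeff_C (by fun_prop)))

theorem continuousCoeff_pairTerm {n : ℕ} (i k : Fin n) : ContinuousCoeff (pairTerm i k) := by
  refine (continuousCoeff_const (X - 1)).mul (ContinuousCoeff.mul ?_ (continuousCoeff_linProd _))
  exact ((continuousCoeff_const X).mul (continuousCoeff_C (by fun_prop))).sub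
    (continuousCoeff_C (by fun_prop))

theorem linProd_erase_update {n : ℕ} (i : Fin n) (x : Fin n → ℝ) (s : ℝ) :
    linProd (Finset.univ.erase i) (Function.update x i s) = linProd (Finset.univ.erase i) x :=
  Finset.prod_congr rfl fun l hl => by
    rw [Function.update_of_ne (Finset.ne_of_mem_erase hl)]

/-- The normalized coefficients of `∏_l (x_l + (1 - x_l) X)`. -/
def bernsteinMean {n : ℕ} (j : ℕ) (x : Fin n → ℝ) : ℝ :=
  (linProd Finset.univ x).coeff j / (n.choose j : ℝ)

theorem continuous_bernsteinMean {n : ℕ} (j : ℕ) : Continuous (bernsteinMean (n := n) j) :=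
  (continuousCoeff_linProd _ j).div_const _

/-- The divergence polynomial of the vector field `x_i (1 - x_i) (X - 1) ∏_{l ≠ i} …`. -/
def divergencePoly {n : ℕ} (a b β : ℝ) (x : Fin n → ℝ) : ℝ[X] :=
  ∑ i, C ((a + 1) * (1 - x i) - b * x i) * ((X - 1) * linProd (Finset.univ.erase i) x) +
    C (β / 2) * ∑ i, ∑ k ∈ Finset.univ.erase i, pairTerm i k x

theorem natDegree_linProd_le {n : ℕ} (x : Fin n → ℝ) : (linProd Finset.univ x).natDegree ≤ n := by
  refine (natDegree_prod_le _ _).trans ?_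
  refine (Finset.sum_le_card_nsmul _ _ 1 fun l _ => ?_).trans (by simp)
  unfold linFactor
  compute_degree

theorem coeff_linProd_eq_zero {n j : ℕ} (hj : n < j) (x : Fin n → ℝ) :
    (linProd Finset.univ x).coeff j = 0 :=
  coeff_eq_zero_of_natDegree_lt ((natDegree_linProd_le x).trans_lt hj)

theorem choose_mul_bernsteinMean {n : ℕ} (j : ℕ) (x : Fin n → ℝ) :
    (linProd Finset.univ x).coeff j = (n.choose j : ℝ) * bernsteinMean j x := by
  unfold bernsteinMean
  rcases le_or_gt j n with h | h
  · have : (n.choose j : ℝ) ≠ 0 := by exact_mod_cast (Nat.choose_pos h).ne'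
    field_simp
  · rw [coeff_linProd_eq_zero h]; simp

/-- The divergence is (X - 1) E, and the k-th coefficient of E involves only Q_k and Q_{k+1}; this
makes `matX` tridiagonal. Normalization by binomials uses (n-k) C(n,k) = (k+1) C(n,k+1). For j = 0
the truncated index j - 1 is harmless since `entryU` vanishes at 0. -/
theorem coeff_divergencePoly {n : ℕ} (a b β : ℝ) (x : Fin n → ℝ) {j : ℕ} (hj : j ≤ n) :
    (divergencePoly a b β x).coeff j = (n.choose j : ℝ) *
      (entryU n b β j * bernsteinMean (j - 1) x + (entryV n a b β j + 1) * bernsteinMean j x +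
        entryW n a b β j * bernsteinMean (j + 1) x) := by
  set Q := linProd Finset.univ x with hQ
  set E : ℝ[X] := C (a + 1) * derivative Q - C b * (C (n : ℝ) * Q - X * derivative Q) +
    C (β / 2) * ((X * derivative (derivative Q) - X * (X * derivative (derivative Q))) +
        C (2 * ((n : ℝ) - 1)) * (X * derivative Q) - C ((n : ℝ) * (n - 1)) * Q) with hE
  have hdiv : divergencePoly a b β x = X * E - E := by
    rw [divergencePoly, sum_weightTerm, sum_pairTerm, hE]
    ring
  have hEk : ∀ k : ℕ, E.coeff k = ((a + 1) * (k + 1) + β / 2 * ((k + 1) * k)) * Q.coeff (k + 1) +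
      (-b * n + b * k - β / 2 * (k * (k - 1)) + β * (n - 1) * k - β / 2 * (n * (n - 1))) *
        Q.coeff k := by
    intro k
    simp only [hE, coeff_add, coeff_sub, coeff_C_mul]
    rcases k with _ | k
    · simp [coeff_derivative]
      ring
    · rcases k with _ | k
      · simp [coeff_derivative, coeff_X_mul]
        ring
      · simp only [coeff_derivative, coeff_X_mul]
        push_cast
        ring
  have hup : ∀ k : ℕ, k ≤ n → ((n : ℝ) - k) * n.choose k = (k + 1) * n.choose (k + 1) := by
    intro k hk
    have := Nat.choose_succ_right_eq n k
    rw [← Nat.cast_sub hk]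
    have h2 : ((n.choose (k + 1) * (k + 1) : ℕ) : ℝ) = ((n.choose k * (n - k) : ℕ) : ℝ) := by
      rw [this]
    push_cast at h2
    linarith
  have hm := fun k => choose_mul_bernsteinMean k x
  rw [hdiv, coeff_sub]
  rcases j with _ | j
  · rw [mul_comm X E, mul_coeff_zero, coeff_X_zero, mul_zero, hEk, hm, hm]
    have := hup 0 (Nat.zero_le n)
    simp only [entryU, entryV, entryW]
    simp only [Nat.cast_zero, zero_add] at this ⊢
    linear_combination ((a + 1)) * bernsteinMean 1 x * this
  · rw [coeff_X_mul, hEk, hEk, hm, hm, hm]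
    have h1 := hup j (by omega)
    have h2 := hup (j + 1) hj
    simp only [entryU, entryV, entryW, Nat.add_sub_cancel]
    push_cast at h1 h2 ⊢
    linear_combination (-(b + β / 2 * ((n : ℝ) - j - 1))) * bernsteinMean j x * h1 +
      ((a + 1) + β / 2 * (j + 1)) * bernsteinMean (j + 1 + 1) x * h2

/-! ### The weak differential equation -/

theorem hasDerivAt_sum_update {n : ℕ} (i : Fin n) (x : Fin n → ℝ) (s : ℝ) :
    HasDerivAt (fun u => ∑ l, Function.update x i u l) 1 s := by
  have := HasDerivAt.fun_sum fun l (_ : l ∈ Finset.univ) =>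
    hasDerivAt_pi.mp (hasDerivAt_update x i s) l
  simpa using this

theorem sum_sum_mul_sub {n : ℕ} (f : Fin n → ℝ) (r : Fin n → Fin n → ℝ)
    (hr : ∀ i k, r k i = -r i k) :
    ∑ i, ∑ k, f i * r i k = 1 / 2 * ∑ i, ∑ k ∈ Finset.univ.erase i, (f i - f k) * r i k := by
  have h1 : ∑ i, ∑ k, f k * r i k = -∑ i, ∑ k, f i * r i k := by
    rw [Finset.sum_comm]
    simp only [← Finset.sum_neg_distrib]
    refine Finset.sum_congr rfl fun i _ => Finset.sum_congr rfl fun k _ => ?_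
    rw [hr]; ring
  have h2 : ∀ i, ∑ k ∈ Finset.univ.erase i, (f i - f k) * r i k = ∑ k, (f i - f k) * r i k := by
    intro i
    rw [← Finset.add_sum_erase _ _ (Finset.mem_univ i)]
    simp
  rw [Finset.sum_congr rfl fun i _ => h2 i]
  simp only [sub_mul, Finset.sum_sub_distrib, h1]
  ring

/-- The `j`-th coefficient of the component `i` of the vector field `(X - 1) ∏_{l ≠ i} …`. -/
def fieldCoeff {n : ℕ} (j : ℕ) (i : Fin n) (x : Fin n → ℝ) : ℝ :=
  ((X - 1) * linProd (Finset.univ.erase i) x).coeff j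

theorem continuous_fieldCoeff {n : ℕ} (j : ℕ) (i : Fin n) : Continuous (fieldCoeff j i) :=
  (continuousCoeff_const (X - 1)).mul (continuousCoeff_linProd _) j

theorem sum_fieldCoeff {n : ℕ} (j : ℕ) (x : Fin n → ℝ) :
    ∑ i, x i * (1 - x i) * fieldCoeff j i x =
      (∑ l, x l - n + j) * (linProd Finset.univ x).coeff j := by
  have := congrArg (fun p => coeff p j) (sum_vectorField x)
  simp only [finsetSum_coeff, coeff_C_mul, coeff_add] at this
  simp only [fieldCoeff]
  rw [this, add_mul]
  congr 1
  rcases j with _ | j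
  · simp
  · rw [coeff_X_mul, coeff_derivative]; push_cast; ring

/-- The kernel (x_i - x_k)/((x_i - x_k)² + e) is antisymmetric, so only differences of field
components enter. Each supplies another x_i - x_k, leaving a quotient in [0, 1] that is bounded
uniformly in e. -/
theorem sum_fieldCoeff_interaction {n : ℕ} (e : ℝ) (j : ℕ) (x : Fin n → ℝ) :
    ∑ i, x i * (1 - x i) * fieldCoeff j i x * ∑ k, (x i - x k) / ((x i - x k) ^ 2 + e) =
      1 / 2 * ∑ i, ∑ k ∈ Finset.univ.erase i, (pairTerm i k x).coeff j *
          ((x i - x k) ^ 2 / ((x i - x k) ^ 2 + e)) := by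
  rw [Finset.sum_congr rfl fun i _ => Finset.mul_sum ..]
  rw [sum_sum_mul_sub (fun i => x i * (1 - x i) * fieldCoeff j i x)
    (fun i k => (x i - x k) / ((x i - x k) ^ 2 + e)) fun i k => by
      rw [← neg_sub (x i) (x k), neg_sq, neg_div]]
  congr 1
  refine Finset.sum_congr rfl fun i _ => Finset.sum_congr rfl fun k hk => ?_
  have := congrArg (fun p => coeff p j)
    (vectorField_sub_vectorField (Finset.ne_of_mem_erase hk) x)
  simp only [coeff_sub, coeff_C_mul] at this
  simp only [fieldCoeff]
  rw [this]
  ring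

/-- The divergence with regularized interaction, apart from the factor coming from the derivative
of the test function. -/
def regDivergence {n : ℕ} (a b β e : ℝ) (j : ℕ) (x : Fin n → ℝ) : ℝ :=
  ∑ i, ((a + 1) * (1 - x i) - b * x i) * fieldCoeff j i x +
    β / 2 * ∑ i, ∑ k ∈ Finset.univ.erase i, (pairTerm i k x).coeff j *
      ((x i - x k) ^ 2 / ((x i - x k) ^ 2 + e))

theorem sum_divergence {n : ℕ} (a b β e p q V : ℝ) (j : ℕ) (x : Fin n → ℝ) :
    ∑ i, ((p * V + q * (V * (β * ∑ k, (x i - x k) / ((x i - x k) ^ 2 + e)))) * fieldCoeff j i x *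
        (x i * (1 - x i)) + q * V * fieldCoeff j i x * ((a + 1) * (1 - x i) - b * x i)) =
      (p * ((∑ l, x l - n + j) * (linProd Finset.univ x).coeff j) +
        q * regDivergence a b β e j x) * V := by
  have h : ∀ i, (p * V + q * (V * (β * ∑ k, (x i - x k) / ((x i - x k) ^ 2 + e)))) *
        fieldCoeff j i x * (x i * (1 - x i)) +
        q * V * fieldCoeff j i x * ((a + 1) * (1 - x i) - b * x i) =
      p * V * (x i * (1 - x i) * fieldCoeff j i x) +
        q * V * (((a + 1) * (1 - x i) - b * x i) * fieldCoeff j i x) +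
        q * V * β *
          (x i * (1 - x i) * fieldCoeff j i x * ∑ k, (x i - x k) / ((x i - x k) ^ 2 + e)) :=
    fun i => by ring
  rw [Finset.sum_congr rfl fun i _ => h i, Finset.sum_add_distrib, Finset.sum_add_distrib,
    ← Finset.mul_sum, ← Finset.mul_sum, ← Finset.mul_sum, sum_fieldCoeff,
    sum_fieldCoeff_interaction, regDivergence]
  ring

theorem continuous_regVandermonde_right {n : ℕ} {β : ℝ} (hβ : 0 ≤ β) (e : ℝ) :
    Continuous (regVandermonde (n := n) β e) := by
  unfold regVandermonde
  refine continuous_finsetProd _ fun p _ => ?_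
  exact (Real.continuous_rpow_const (by positivity)).comp (by fun_prop)

theorem tendsto_regVandermonde {n : ℕ} {β : ℝ} (hβ : 0 ≤ β) (x : Fin n → ℝ) :
    Tendsto (fun e => regVandermonde β e x) (𝓝[>] 0) (𝓝 (regVandermonde β 0 x)) :=
  (((continuous_regVandermonde hβ).comp (by fun_prop : Continuous fun e : ℝ => (e, x))).tendsto
    0).mono_left nhdsWithin_le_nhds

theorem continuous_sum_weight_fieldCoeff {n : ℕ} (a b : ℝ) (j : ℕ) :
    Continuous fun x : Fin n → ℝ =>
      ∑ i, ((a + 1) * (1 - x i) - b * x i) * fieldCoeff j i x := by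
  refine continuous_finsetSum _ fun i _ => ?_
  have h : Continuous fun x : Fin n → ℝ => (a + 1) * (1 - x i) - b * x i := by fun_prop
  exact h.mul (continuous_fieldCoeff j i)

theorem continuous_regDivergence {n : ℕ} (a b β : ℝ) {e : ℝ} (he : 0 < e) (j : ℕ) :
    Continuous (regDivergence (n := n) a b β e j) := by
  refine (continuous_sum_weight_fieldCoeff a b j).add (continuous_const.mul
    (continuous_finsetSum _ fun i _ => continuous_finsetSum _ fun k _ => ?_))
  have h : Continuous fun x : Fin n → ℝ => (x i - x k) ^ 2 / ((x i - x k) ^ 2 + e) :=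
    Continuous.div (by fun_prop) (by fun_prop) fun x => by positivity
  exact (continuousCoeff_pairTerm i k j).mul h

/-- The vector field times the test function and the regularized Vandermonde factor. -/
def testField {n : ℕ} (β e : ℝ) (φ : ℝ → ℝ) (j : ℕ) (i : Fin n) (x : Fin n → ℝ) : ℝ :=
  φ (∑ l, x l) * regVandermonde β e x * fieldCoeff j i x

/-- The derivative of `testField` in the direction `i`. -/
def testFieldDeriv {n : ℕ} (β e : ℝ) (φ φ' : ℝ → ℝ) (j : ℕ) (i : Fin n) (x : Fin n → ℝ) : ℝ :=
  (φ' (∑ l, x l) * regVandermonde β e x +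
    φ (∑ l, x l) * (regVandermonde β e x *
      (β * ∑ k, (x i - x k) / ((x i - x k) ^ 2 + e)))) * fieldCoeff j i x

theorem continuous_testField {n : ℕ} {β : ℝ} (hβ : 0 ≤ β) (e : ℝ) {φ : ℝ → ℝ}
    (hφ : Continuous φ) (j : ℕ) (i : Fin n) : Continuous (testField β e φ j i) := by
  have hS : Continuous fun x : Fin n → ℝ => ∑ l, x l := by fun_prop
  exact ((hφ.comp hS).mul (continuous_regVandermonde_right hβ e)).mul (continuous_fieldCoeff j i)

theorem continuous_testFieldDeriv {n : ℕ} {β e : ℝ} (hβ : 0 ≤ β) (he : 0 < e) {φ φ' : ℝ → ℝ}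
    (hφ : Continuous φ) (hφ' : Continuous φ') (j : ℕ) (i : Fin n) :
    Continuous (testFieldDeriv β e φ φ' j i) := by
  have hS : Continuous fun x : Fin n → ℝ => ∑ l, x l := by fun_prop
  have hr : ∀ k, Continuous fun x : Fin n → ℝ => (x i - x k) / ((x i - x k) ^ 2 + e) := fun k =>
    Continuous.div (by fun_prop) (by fun_prop) fun x => by positivity
  have hV := continuous_regVandermonde_right (n := n) hβ e
  have h1 := (hφ.comp hS).mul (hV.mul (continuous_const (y := β) |>.mul
    (continuous_finsetSum Finset.univ fun k _ => hr k)))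
  exact (((hφ'.comp hS).mul hV).add h1).mul (continuous_fieldCoeff j i)

theorem hasDerivAt_testField {n : ℕ} (β : ℝ) {e : ℝ} (he : 0 < e) {φ φ' : ℝ → ℝ}
    (hφ : ∀ t, HasDerivAt φ (φ' t) t) (j : ℕ) (i : Fin n) (x : Fin n → ℝ) (s : ℝ) :
    HasDerivAt (fun u => testField β e φ j i (Function.update x i u))
      (testFieldDeriv β e φ φ' j i (Function.update x i s)) s := by
  have hci : ∀ u, fieldCoeff j i (Function.update x i u) = fieldCoeff j i x := fun u => by
    simp only [fieldCoeff, linProd_erase_update]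
  have d1 : HasDerivAt (fun u => φ (∑ l, Function.update x i u l))
      (φ' (∑ l, Function.update x i s l)) s := by
    have := (hφ (∑ l, Function.update x i s l)).comp s (hasDerivAt_sum_update i x s)
    rwa [mul_one] at this
  simp only [testField, testFieldDeriv, hci]
  exact (d1.fun_mul (hasDerivAt_regVandermonde β he i x s)).mul_const _

/-- The weak differential equation, with regularized interaction. -/
theorem integral_regularized_eq_zero {n : ℕ} {a b β e : ℝ} (ha : -1 < a) (hb : 0 < b)
    (hβ : 0 ≤ β) (he : 0 < e) {φ φ' : ℝ → ℝ} (hφ : ∀ t, HasDerivAt φ (φ' t) t)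
    (hφ' : Continuous φ') (j : ℕ) :
    ∫ x : Fin (n + 1) → ℝ, ((φ' (∑ l, x l) * ((∑ l, x l - ((n + 1 : ℕ) : ℝ) + j) *
        (linProd Finset.univ x).coeff j) +
      φ (∑ l, x l) * regDivergence a b β e j x) * regVandermonde β e x) *
      ∏ l, betaWeight a b (x l) = 0 := by
  have hφc : Continuous φ := continuous_iff_continuousAt.mpr fun t => (hφ t).continuousAt
  have hh := fun i : Fin (n + 1) => continuous_testField hβ e hφc j i
  have hh' := fun i : Fin (n + 1) => continuous_testFieldDeriv hβ he hφc hφ' j i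
  have hzero := fun i : Fin (n + 1) => integral_prod_betaWeight_divergence ha hb i (hh i) (hh' i)
    (hasDerivAt_testField β he hφ j i)
  have hint : ∀ i : Fin (n + 1), Integrable fun x : Fin (n + 1) → ℝ =>
      (testFieldDeriv β e φ φ' j i x * (x i * (1 - x i)) +
        testField β e φ j i x * ((a + 1) * (1 - x i) - b * x i)) *
        ∏ l, betaWeight a b (x l) := by
    intro i
    have h1 : Continuous fun x : Fin (n + 1) → ℝ => x i * (1 - x i) := by fun_prop
    have h2 : Continuous fun x : Fin (n + 1) → ℝ => (a + 1) * (1 - x i) - b * x i := by fun_prop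
    exact integrable_mul_prod_betaWeight ha hb (((hh' i).mul h1).add ((hh i).mul h2))
  have hsum := integral_finsetSum Finset.univ fun i _ => hint i
  rw [Finset.sum_eq_zero fun i _ => hzero i] at hsum
  rw [← hsum]
  refine integral_congr_ae (ae_of_all _ fun x => ?_)
  simp only [testField, testFieldDeriv]
  rw [← Finset.sum_mul, sum_divergence]

/-- Off the diagonal the quotient tends to 1. On it the quotient is 0, but so is the limit: the
Vandermonde factor vanishes there if β > 0, and the prefactor vanishes if β = 0. -/
theorem tendsto_interaction {n : ℕ} {β : ℝ} (hβ : 0 ≤ β) (x : Fin n → ℝ) {i k : Fin n}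
    (hik : i ≠ k) :
    Tendsto (fun e => β / 2 * ((x i - x k) ^ 2 / ((x i - x k) ^ 2 + e) * regVandermonde β e x))
      (𝓝[>] 0) (𝓝 (β / 2 * regVandermonde β 0 x)) := by
  rcases hβ.eq_or_lt with rfl | hβ'
  · simp
  have hV := tendsto_regVandermonde hβ x
  refine Tendsto.const_mul _ ?_
  by_cases h : x i = x k
  · simp only [h, sub_self]
    rw [regVandermonde_zero_of_eq hβ' hik h]
    simp
  · have h2 : (x i - x k) ^ 2 ≠ 0 := pow_ne_zero 2 (sub_ne_zero.mpr h)
    have h3 : Tendsto (fun e => (x i - x k) ^ 2 / ((x i - x k) ^ 2 + e)) (𝓝[>] 0) (𝓝 1) := by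
      have : ContinuousAt (fun e => (x i - x k) ^ 2 / ((x i - x k) ^ 2 + e)) 0 :=
        ContinuousAt.div (by fun_prop) (by fun_prop) (by simpa using h2)
      have h4 := this.tendsto
      simp only [add_zero, div_self h2] at h4
      exact h4.mono_left nhdsWithin_le_nhds
    simpa using h3.mul hV

theorem coeff_divergencePoly_eq {n : ℕ} (a b β : ℝ) (j : ℕ) (x : Fin n → ℝ) :
    (divergencePoly a b β x).coeff j =
      ∑ i, ((a + 1) * (1 - x i) - b * x i) * fieldCoeff j i x +
        β / 2 * ∑ i, ∑ k ∈ Finset.univ.erase i, (pairTerm i k x).coeff j := by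
  simp only [divergencePoly, coeff_add, finsetSum_coeff, coeff_C_mul, fieldCoeff]

theorem continuous_coeff_divergencePoly {n : ℕ} (a b β : ℝ) (j : ℕ) :
    Continuous fun x : Fin n → ℝ => (divergencePoly a b β x).coeff j := by
  simp only [coeff_divergencePoly_eq]
  exact (continuous_sum_weight_fieldCoeff a b j).add (continuous_const.mul
    (continuous_finsetSum _ fun i _ => continuous_finsetSum _ fun k _ =>
      continuousCoeff_pairTerm i k j))

theorem tendsto_regDivergence {n : ℕ} {β : ℝ} (a b : ℝ) (hβ : 0 ≤ β) (j : ℕ) (x : Fin n → ℝ) :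
    Tendsto (fun e => regDivergence a b β e j x * regVandermonde β e x)
      (𝓝[>] 0) (𝓝 ((divergencePoly a b β x).coeff j * regVandermonde β 0 x)) := by
  have hV := tendsto_regVandermonde hβ x
  have hP : Tendsto (fun e => ∑ i, ∑ k ∈ Finset.univ.erase i, (pairTerm i k x).coeff j *
      (β / 2 * ((x i - x k) ^ 2 / ((x i - x k) ^ 2 + e) * regVandermonde β e x))) (𝓝[>] 0)
      (𝓝 (∑ i, ∑ k ∈ Finset.univ.erase i, (pairTerm i k x).coeff j *
        (β / 2 * regVandermonde β 0 x))) :=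
    tendsto_finsetSum _ fun i _ => tendsto_finsetSum _ fun k hk =>
      (tendsto_interaction hβ x (Finset.ne_of_mem_erase hk).symm).const_mul _
  have := (hV.const_mul (∑ i, ((a + 1) * (1 - x i) - b * x i) * fieldCoeff j i x)).add hP
  rw [coeff_divergencePoly_eq]
  convert this using 1
  · funext e
    rw [regDivergence, add_mul]
    congr 1
    simp only [Finset.sum_mul, Finset.mul_sum]
    exact Finset.sum_congr rfl fun i _ => Finset.sum_congr rfl fun k _ => by ring
  · congr 1
    rw [add_mul]
    congr 1
    simp only [Finset.sum_mul, Finset.mul_sum]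
    exact Finset.sum_congr rfl fun i _ => Finset.sum_congr rfl fun k _ => by ring

theorem abs_regDivergence_le {n : ℕ} {a b β e : ℝ} (hβ : 0 ≤ β) (he : 0 < e) (j : ℕ)
    (x : Fin n → ℝ) :
    |regDivergence a b β e j x| ≤ |∑ i, ((a + 1) * (1 - x i) - b * x i) * fieldCoeff j i x| +
      β / 2 * ∑ i, ∑ k ∈ Finset.univ.erase i, |(pairTerm i k x).coeff j| := by
  refine (abs_add_le _ _).trans (add_le_add le_rfl ?_)
  rw [abs_mul, abs_of_nonneg (by positivity : 0 ≤ β / 2)]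
  refine mul_le_mul_of_nonneg_left ?_ (by positivity)
  refine (Finset.abs_sum_le_sum_abs _ _).trans (Finset.sum_le_sum fun i _ => ?_)
  refine (Finset.abs_sum_le_sum_abs _ _).trans (Finset.sum_le_sum fun k _ => ?_)
  rw [abs_mul, abs_of_nonneg (by positivity : 0 ≤ (x i - x k) ^ 2 / ((x i - x k) ^ 2 + e))]
  refine mul_le_of_le_one_right (abs_nonneg _) (div_le_one_of_le₀ ?_ (by positivity))
  linarith

/-- The weak form of the differential equation, integrated against a test function of `∑ x_l`. -/
theorem integral_weak_eq_zero {n : ℕ} {a b β : ℝ} (ha : -1 < a) (hb : 0 < b)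
    (hβ : 0 ≤ β) {φ φ' : ℝ → ℝ} (hφ : ∀ t, HasDerivAt φ (φ' t) t)
    (hφ' : Continuous φ') (j : ℕ) :
    ∫ x : Fin (n + 1) → ℝ, ((φ' (∑ l, x l) * ((∑ l, x l - ((n + 1 : ℕ) : ℝ) + j) *
        (linProd Finset.univ x).coeff j) +
      φ (∑ l, x l) * (divergencePoly a b β x).coeff j) * regVandermonde β 0 x) *
      ∏ l, betaWeight a b (x l) = 0 := by
  have hφc : Continuous φ := continuous_iff_continuousAt.mpr fun t => (hφ t).continuousAt
  have hS : Continuous fun x : Fin (n + 1) → ℝ => ∑ l, x l := by fun_prop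
  let A : (Fin (n + 1) → ℝ) → ℝ := fun x => φ' (∑ l, x l) *
    ((∑ l, x l - ((n + 1 : ℕ) : ℝ) + j) * (linProd Finset.univ x).coeff j)
  have hA : Continuous A := (hφ'.comp hS).mul
    (((hS.sub continuous_const).add continuous_const).mul (continuousCoeff_linProd _ j))
  let B : (Fin (n + 1) → ℝ) → ℝ := fun x =>
    |∑ i, ((a + 1) * (1 - x i) - b * x i) * fieldCoeff j i x| +
      β / 2 * ∑ i, ∑ k ∈ Finset.univ.erase i, |(pairTerm i k x).coeff j|
  have hB : Continuous B := (continuous_sum_weight_fieldCoeff a b j).abs.add (continuous_const.mul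
    (continuous_finsetSum _ fun i _ => continuous_finsetSum _ fun k _ =>
      (continuousCoeff_pairTerm i k j).abs))
  have key : Tendsto (fun e => ∫ x : Fin (n + 1) → ℝ, ((A x + φ (∑ l, x l) *
        regDivergence a b β e j x) * regVandermonde β e x) * ∏ l, betaWeight a b (x l)) (𝓝[>] 0)
      (𝓝 (∫ x : Fin (n + 1) → ℝ, ((A x + φ (∑ l, x l) * (divergencePoly a b β x).coeff j) *
        regVandermonde β 0 x) * ∏ l, betaWeight a b (x l))) := by
    -- The regularized Vandermonde factor increases with e, so its value at e = 1 dominates for 0 <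
    -- e < 1.
    refine tendsto_integral_filter_of_dominated_convergence
      (fun x => ((|A x| + |φ (∑ l, x l)| * B x) * regVandermonde β 1 x) *
        ∏ l, betaWeight a b (x l)) ?_ ?_ ?_ ?_
    · filter_upwards [self_mem_nhdsWithin] with e he
      exact (((hA.add ((hφc.comp hS).mul (continuous_regDivergence a b β he j))).mul (continuous_regVandermonde_right hβ e)).aestronglyMeasurable).mul
        (integrable_prod_betaWeight ha hb _).1
    · filter_upwards [Ioo_mem_nhdsGT zero_lt_one] with e he
      refine ae_of_all _ fun x => ?_
      rw [norm_mul, Real.norm_of_nonneg (prod_betaWeight_nonneg a b x)]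
      refine mul_le_mul_of_nonneg_right ?_ (prod_betaWeight_nonneg a b x)
      rw [norm_mul, Real.norm_of_nonneg (regVandermonde_nonneg he.1.le x)]
      refine mul_le_mul ?_ (regVandermonde_mono hβ he.1.le he.2.le x)
        (regVandermonde_nonneg he.1.le x) (by positivity)
      refine (norm_add_le _ _).trans (add_le_add le_rfl ?_)
      rw [norm_mul]
      exact mul_le_mul_of_nonneg_left (abs_regDivergence_le hβ he.1 j x) (norm_nonneg _)
    · exact integrable_mul_prod_betaWeight ha hb
        ((hA.abs.add ((hφc.comp hS).abs.mul hB)).mul (continuous_regVandermonde_right hβ 1))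
    · refine ae_of_all _ fun x => Tendsto.mul_const _ ?_
      have hV := tendsto_regVandermonde hβ x
      have := (hV.const_mul (A x)).add ((tendsto_regDivergence a b hβ j x).const_mul (φ (∑ l, x l)))
      simpa only [add_mul, mul_assoc] using this
  refine tendsto_nhds_unique key (Tendsto.congr' ?_ tendsto_const_nhds)
  filter_upwards [self_mem_nhdsWithin] with e he
  exact (integral_regularized_eq_zero ha hb hβ he hφ hφ' j).symm

/-! ### From weak to classical derivatives -/

/-- A continuous function with a continuous weak derivative is differentiable. -/
theorem hasDerivAt_of_weak_of_continuous {f d : ℝ → ℝ} (hf : Continuous f) (hd : Continuous d)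
    {A B : ℝ} (hAB : A < B)
    (h : ∀ φ φ' : ℝ → ℝ, (∀ t, HasDerivAt φ (φ' t) t) → Continuous φ' →
      (∀ t, t ∉ Set.Ioo A B → φ t = 0 ∧ φ' t = 0) →
      ∫ t in A..B, (φ' t * f t + φ t * d t) = 0)
    {t : ℝ} (ht : t ∈ Set.Ioo A B) : HasDerivAt f (d t) t := by
  set D : ℝ → ℝ := fun t => ∫ s in A..t, d s with hDdef
  have hD : ∀ t, HasDerivAt D (d t) t := fun t => (hd.integral_hasStrictDerivAt A t).hasDerivAt
  have hDc : Continuous D := continuous_iff_continuousAt.mpr fun t => (hD t).continuousAt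
  set w : ℝ → ℝ := fun t => max 0 ((t - A) * (B - t)) with hw
  have hwc : Continuous w := by fun_prop
  have hwout : ∀ t, t ∉ Set.Ioo A B → w t = 0 := by
    intro t ht
    refine max_eq_left ?_
    rw [Set.mem_Ioo, not_and_or, not_lt, not_lt] at ht
    rcases ht with ht | ht
    · exact mul_nonpos_of_nonpos_of_nonneg (by linarith) (by linarith)
    · exact mul_nonpos_of_nonneg_of_nonpos (by linarith) (by linarith)
  have hwin : ∀ t, t ∈ Set.Ioo A B → 0 < w t := fun t ht =>
    lt_max_of_lt_right (mul_pos (by linarith [ht.1]) (by linarith [ht.2]))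
  have hwpos : 0 < ∫ t in A..B, w t :=
    intervalIntegral.intervalIntegral_pos_of_pos_on (hwc.intervalIntegrable _ _) hwin hAB
  -- κ is the w-weighted mean of f - D, so ψ = w (f - D - κ) has integral zero and its primitive φ
  -- vanishes outside (A, B). Testing with φ then forces ∫ w (f - D - κ)² = 0, whence f = D + κ.
  set κ : ℝ := (∫ t in A..B, w t * (f t - D t)) / ∫ t in A..B, w t with hκ
  set ψ : ℝ → ℝ := fun t => w t * (f t - D t - κ) with hψ
  have hψc : Continuous ψ := by fun_prop
  have hψint : ∫ t in A..B, ψ t = 0 := by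
    have : ∀ t, ψ t = w t * (f t - D t) - κ * w t := fun t => by simp only [hψ]; ring
    simp only [this]
    rw [intervalIntegral.integral_sub ((by fun_prop : Continuous _).intervalIntegrable _ _)
      ((by fun_prop : Continuous _).intervalIntegrable _ _), intervalIntegral.integral_const_mul, hκ]
    field_simp
    ring
  have hψout : ∀ t, t ∉ Set.Ioo A B → ψ t = 0 := fun t ht => by simp only [hψ, hwout t ht, zero_mul]
  set φ : ℝ → ℝ := fun t => ∫ s in A..t, ψ s with hφdef
  have hφ : ∀ t, HasDerivAt φ (ψ t) t := fun t => (hψc.integral_hasStrictDerivAt A t).hasDerivAt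
  have hφc : Continuous φ := continuous_iff_continuousAt.mpr fun t => (hφ t).continuousAt
  have hφout : ∀ t, t ∉ Set.Ioo A B → φ t = 0 := by
    intro t ht
    rw [Set.mem_Ioo, not_and_or, not_lt, not_lt] at ht
    rcases ht with ht | ht
    · refine intervalIntegral.integral_zero_ae (ae_of_all _ fun s hs => hψout s fun hs' => ?_)
      rw [Set.uIoc_of_ge ht] at hs
      linarith [hs.2, hs'.1]
    · have : φ t = (∫ s in A..B, ψ s) + ∫ s in B..t, ψ s :=
        (intervalIntegral.integral_add_adjacent_intervals (hψc.intervalIntegrable _ _)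
          (hψc.intervalIntegrable _ _)).symm
      rw [this, hψint, zero_add]
      refine intervalIntegral.integral_zero_ae (ae_of_all _ fun s hs => hψout s fun hs' => ?_)
      rw [Set.uIoc_of_le ht] at hs
      linarith [hs.1, hs'.2]
  have h1 := h φ ψ hφ hψc fun t ht => ⟨hφout t ht, hψout t ht⟩
  have h2 : ∫ t in A..B, (ψ t * D t + φ t * d t) = 0 := by
    rw [intervalIntegral.integral_deriv_mul_eq_sub_of_hasDerivAt hφc.continuousOn hDc.continuousOn
      (fun t _ => hφ t) (fun t _ => hD t) (hψc.intervalIntegrable _ _) (hd.intervalIntegrable _ _),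
      hφout A (by simp), hφout B (by simp)]
    ring
  have h3 : ∫ t in A..B, w t * (f t - D t - κ) ^ 2 = 0 := by
    have : ∀ t, w t * (f t - D t - κ) ^ 2 =
        (ψ t * f t + φ t * d t) - (ψ t * D t + φ t * d t) - κ * ψ t := fun t => by
      simp only [hψ]; ring
    simp only [this]
    rw [intervalIntegral.integral_sub ((by fun_prop : Continuous _).intervalIntegrable _ _)
      ((by fun_prop : Continuous _).intervalIntegrable _ _),
      intervalIntegral.integral_sub ((by fun_prop : Continuous _).intervalIntegrable _ _)
      ((by fun_prop : Continuous _).intervalIntegrable _ _),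
      intervalIntegral.integral_const_mul, h1, h2, hψint]
    ring
  have h4 : ∀ s ∈ Set.Ioo A B, f s = D s + κ := by
    intro s hs
    by_contra hne
    have hne' : f s - D s - κ ≠ 0 := fun h => hne (by linarith)
    refine absurd h3 (ne_of_gt ?_)
    refine intervalIntegral.integral_pos hAB (by fun_prop) (fun u _ => ?_)
      ⟨s, Set.Ioo_subset_Icc_self hs, ?_⟩
    · exact mul_nonneg (le_max_left _ _) (sq_nonneg _)
    · have := hwin s hs
      positivity
  refine ((hD t).add_const κ).congr_of_eventuallyEq ?_
  filter_upwards [Ioo_mem_nhds ht.1 ht.2] with s hs using h4 s hs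

theorem hasDerivAt_of_weak {f d : ℝ → ℝ} {A B : ℝ} (hAB : A < B)
    (hf : ContinuousOn f (Set.Icc A B)) (hd : ContinuousOn d (Set.Icc A B))
    (h : ∀ φ φ' : ℝ → ℝ, (∀ t, HasDerivAt φ (φ' t) t) → Continuous φ' →
      (∀ t, t ∉ Set.Ioo A B → φ t = 0 ∧ φ' t = 0) →
      (∫ t, φ' t * f t) + ∫ t, φ t * d t = 0)
    {t : ℝ} (ht : t ∈ Set.Ioo A B) : HasDerivAt f (d t) t := by
  set f₁ := Set.IccExtend hAB.le (Set.domRestrict (Set.Icc A B) f) with hf₁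
  set d₁ := Set.IccExtend hAB.le (Set.domRestrict (Set.Icc A B) d) with hd₁
  have hfe : ∀ s ∈ Set.Icc A B, f₁ s = f s := fun s hs => Set.IccExtend_of_mem _ _ hs
  have hde : ∀ s ∈ Set.Icc A B, d₁ s = d s := fun s hs => Set.IccExtend_of_mem _ _ hs
  have hf₁c : Continuous f₁ := (continuousOn_iff_continuous_domRestrict.mp hf).Icc_extend'
  have hd₁c : Continuous d₁ := (continuousOn_iff_continuous_domRestrict.mp hd).Icc_extend'
  have key : HasDerivAt f₁ (d₁ t) t := by
    refine hasDerivAt_of_weak_of_continuous hf₁c hd₁c hAB (fun φ φ' hφ hφ' hout => ?_) ht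
    have hφc : Continuous φ := continuous_iff_continuousAt.mpr fun t => (hφ t).continuousAt
    have hsub : ∀ (u v v₁ : ℝ → ℝ), (∀ t, t ∉ Set.Ioo A B → u t = 0) →
        (∀ s ∈ Set.Icc A B, v₁ s = v s) → ∫ t in A..B, u t * v₁ t = ∫ t, u t * v t := by
      intro u v v₁ hu hv
      rw [intervalIntegral.integral_eq_integral_of_support_subset]
      · refine integral_congr_ae (ae_of_all _ fun s => ?_)
        by_cases hs : s ∈ Set.Ioo A B
        · simp only [hv s (Set.Ioo_subset_Icc_self hs)]
        · simp only [hu s hs, zero_mul]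
      · intro s hs
        refine Set.Ioo_subset_Ioc_self ?_
        by_contra hs'
        exact hs (by simp only [hu s hs', zero_mul])
    rw [intervalIntegral.integral_add (f := fun t => φ' t * f₁ t) (g := fun t => φ t * d₁ t)
      ((hφ'.mul hf₁c).intervalIntegrable _ _)
      ((hφc.mul hd₁c).intervalIntegrable _ _),
      hsub φ' f f₁ (fun t ht => (hout t ht).2) hfe, hsub φ d d₁ (fun t ht => (hout t ht).1) hde]
    exact h φ φ' hφ hφ' hout
  rw [hde t (Set.Ioo_subset_Icc_self ht)] at key
  refine key.congr_of_eventuallyEq ?_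
  filter_upwards [Ioo_mem_nhds ht.1 ht.2] with s hs
  exact (hfe s (Set.Ioo_subset_Icc_self hs)).symm

/-! ### Identification of the components of G -/

theorem regVandermonde_zero {n : ℕ} (β : ℝ) (x : Fin n → ℝ) :
    regVandermonde β 0 x = ∏ j, ∏ k ∈ Finset.Ioi j, |x k - x j| ^ β := by
  have h1 : regVandermonde β 0 x = ∏ i, ∏ k ∈ {i}ᶜ, |x k - x i| ^ (β / 2) := by
    rw [regVandermonde, ← Finset.prod_finset_product' (Finset.univ : Finset (Fin n)).offDiag
      Finset.univ (fun i : Fin n => ({i}ᶜ : Finset (Fin n)))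
      (by intro p; simp [eq_comm]) (f := fun i k => |x k - x i| ^ (β / 2))]
    refine Finset.prod_congr rfl fun p _ => ?_
    rw [add_zero, abs_sub_comm, ← sq_abs, ← Real.rpow_natCast, ← Real.rpow_mul (abs_nonneg _)]
    congr 1
    push_cast
    ring
  rw [h1, ← Finset.prod_prod_Ioi_mul_eq_prod_prod_off_diag fun k i => |x k - x i| ^ (β / 2)]
  refine Finset.prod_congr rfl fun i _ => Finset.prod_congr rfl fun k hk => ?_
  rw [abs_sub_comm (x i), ← sq, ← Real.rpow_natCast, ← Real.rpow_mul (abs_nonneg _)]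
  congr 1
  push_cast
  ring

/-- The substitution of 1 + X for X turns x + (1-x)X into 1 + (1-x)X, and the product of these
generates the elementary symmetric polynomials of the 1 - x_l. -/
theorem eval_esymm_one_sub {n : ℕ} (p : ℕ) (x : Fin n → ℝ) :
    MvPolynomial.eval (fun l => 1 - x l) (MvPolynomial.esymm (Fin n) ℝ p) =
      ∑ k ∈ Finset.range (n + 1), (k.choose p : ℝ) * (linProd Finset.univ x).coeff k := by
  have h1 : (linProd Finset.univ x).comp (1 + X) = ∏ l, (1 + X * C (1 - x l)) := by
    rw [linProd, prod_comp]
    refine Finset.prod_congr rfl fun l _ => ?_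
    simp only [linFactor, add_comp, C_comp, mul_comp, X_comp, C_sub, C_1, sub_comp, one_comp]
    ring
  have h2 : ((linProd Finset.univ x).comp (1 + X)).coeff p =
      ∑ k ∈ Finset.range (n + 1), (k.choose p : ℝ) * (linProd Finset.univ x).coeff k := by
    conv_lhs => rw [as_sum_range_C_mul_X_pow' (linProd Finset.univ x)
      (Nat.lt_succ_of_le (natDegree_linProd_le x))]
    rw [Polynomial.sum_comp, finsetSum_coeff]
    refine Finset.sum_congr rfl fun k _ => ?_
    rw [mul_comp, C_comp, X_pow_comp, coeff_C_mul, coeff_one_add_X_pow, mul_comm]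
  rw [← h2, h1, Finset.prod_one_add, finsetSum_coeff, MvPolynomial.esymm, map_sum,
    Finset.powersetCard_eq_filter, Finset.sum_filter]
  refine Finset.sum_congr rfl fun S _ => ?_
  rw [Finset.prod_mul_distrib, Finset.prod_const, ← map_prod, mul_comm, coeff_C_mul, coeff_X_pow,
    map_prod]
  simp only [MvPolynomial.eval_X, mul_ite, mul_one, mul_zero, eq_comm]

theorem choose_mul_choose_eq {n p k : ℕ} (hp : p ≤ n) (hk : k ≤ n) :
    (k.choose p : ℝ) * n.choose k = n.choose p * ((n - p).choose (n - k) : ℝ) := by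
  rcases le_or_gt p k with h | h
  · have h1 := Nat.choose_mul (n := n) (k := k) (s := p) h
    have h2 : (n - p).choose (n - k) = (n - p).choose (k - p) := by
      rw [← Nat.choose_symm (by omega : n - k ≤ n - p)]
      congr 1
      omega
    rw [h2, mul_comm]
    exact_mod_cast h1
  · rw [Nat.choose_eq_zero_of_lt h, Nat.choose_eq_zero_of_lt (by omega : n - p < n - k)]
    simp

theorem eval_esymm_div_choose {n p : ℕ} (hp : p ≤ n) (x : Fin n → ℝ) :
    1 / (n.choose p : ℝ) *
      MvPolynomial.eval (fun l => 1 - x l) (MvPolynomial.esymm (Fin n) ℝ p) =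
      ∑ k : Fin (n + 1), ((n - p).choose (n - k) : ℝ) * bernsteinMean k x := by
  rw [eval_esymm_one_sub, Finset.mul_sum,
    Finset.sum_range fun k => 1 / (n.choose p : ℝ) * ((k.choose p : ℝ) *
      (linProd Finset.univ x).coeff k)]
  refine Finset.sum_congr rfl fun k _ => ?_
  have h0 : (n.choose p : ℝ) ≠ 0 := by exact_mod_cast (Nat.choose_pos hp).ne'
  have h1 := choose_mul_choose_eq hp (Nat.lt_succ_iff.mp k.isLt)
  rw [choose_mul_bernsteinMean]
  field_simp
  linear_combination bernsteinMean (k : ℕ) x * h1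

theorem integrand_eq (n : ℕ) (a b β : ℝ) (p : ℕ) : integrand n a b β p = fun x =>
    (regVandermonde β 0 x *
      MvPolynomial.eval (fun l => 1 - x l) (MvPolynomial.esymm (Fin n) ℝ p)) *
      ∏ l, betaWeight a b (x l) := by
  funext x
  rw [integrand]
  by_cases hx : x ∈ Set.univ.pi fun _ : Fin n => Set.Ioo (0 : ℝ) 1
  · rw [Set.indicator_of_mem hx, regVandermonde_zero]
    have : ∏ l, betaWeight a b (x l) = ∏ l, x l ^ a * (1 - x l) ^ (b - 1) :=
      Finset.prod_congr rfl fun l _ => Set.indicator_of_mem (hx l (Set.mem_univ l)) _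
    rw [this]
    ring
  · rw [Set.indicator_of_notMem hx]
    have : ∏ l, betaWeight a b (x l) = 0 := by
      by_contra h0
      exact hx fun l _ => mem_Ioo_of_prod_betaWeight_ne_zero h0 l
    rw [this, mul_zero]

/-! ### The differential equation for slice integrals and for G -/

/-- The integral of `f` against the Selberg weight over the hyperplane `∑ x_l = t`. -/
def sliceIntegral {n : ℕ} (a b β : ℝ) (f : (Fin n → ℝ) → ℝ) : ℝ → ℝ :=
  deltaIntegral fun x => (regVandermonde β 0 x * f x) * ∏ l, betaWeight a b (x l)

section

variable {n : ℕ} {a b β : ℝ}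

theorem deltaIntegrable_selberg (ha : -1 < a) (hb : 0 < b) (hβ : 0 ≤ β)
    {f : (Fin (n + 1) → ℝ) → ℝ} (hf : Continuous f) {t : ℝ}
    (ht : ∀ m : ℕ, m ≤ n + 1 → t ≠ m) :
    DeltaIntegrable (fun x => (regVandermonde β 0 x * f x) * ∏ l, betaWeight a b (x l)) t :=
  (deltaIntegrable_and_continuousAt ha hb ((continuous_regVandermonde_right hβ 0).mul hf) ht).1

theorem continuousAt_sliceIntegral (ha : -1 < a) (hb : 0 < b) (hβ : 0 ≤ β)
    {f : (Fin (n + 1) → ℝ) → ℝ} (hf : Continuous f) {t : ℝ}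
    (ht : ∀ m : ℕ, m ≤ n + 1 → t ≠ m) : ContinuousAt (sliceIntegral a b β f) t :=
  (deltaIntegrable_and_continuousAt ha hb ((continuous_regVandermonde_right hβ 0).mul hf) ht).2

theorem sliceIntegral_sum (ha : -1 < a) (hb : 0 < b) (hβ : 0 ≤ β) {ι : Type*} (S : Finset ι)
    (c : ι → ℝ) {f : ι → (Fin (n + 1) → ℝ) → ℝ} (hf : ∀ i, Continuous (f i)) {t : ℝ}
    (ht : ∀ m : ℕ, m ≤ n + 1 → t ≠ m) :
    sliceIntegral a b β (fun x => ∑ i ∈ S, c i * f i x) t =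
      ∑ i ∈ S, c i * sliceIntegral a b β (f i) t := by
  have h := fun i => deltaIntegrable_selberg ha hb hβ (hf i) ht
  simp only [sliceIntegral, deltaIntegral_succ]
  simp only [deltaIntegrable_succ] at h
  simp only [← integral_const_mul]
  rw [← integral_finsetSum _ fun i _ => (h i).const_mul (c i)]
  refine integral_congr_ae (ae_of_all _ fun y => ?_)
  simp only [Finset.mul_sum, Finset.sum_mul]
  exact Finset.sum_congr rfl fun i _ => by ring

theorem continuous_eval_esymm (p : ℕ) : Continuous fun x : Fin n → ℝ =>
    MvPolynomial.eval (fun l => 1 - x l) (MvPolynomial.esymm (Fin n) ℝ p) := by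
  simp only [eval_esymm_one_sub]
  exact continuous_finsetSum _ fun k _ => continuous_const.mul (continuousCoeff_linProd _ k)

theorem deltaIntegrable_integrand (ha : -1 < a) (hb : 0 < b) (hβ : 0 ≤ β) (p : ℕ) {t : ℝ}
    (ht : ∀ m : ℕ, m ≤ n + 1 → t ≠ m) : DeltaIntegrable (integrand (n + 1) a b β p) t := by
  rw [integrand_eq]
  exact deltaIntegrable_selberg ha hb hβ (continuous_eval_esymm p) ht

/-- Off the integers, the components of `G` are the integrals of the normalized coefficients of
`∏_l (x_l + (1 - x_l) X)`. -/
theorem vecG_eq (ha : -1 < a) (hb : 0 < b) (hβ : 0 ≤ β) {t : ℝ}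
    (ht : ∀ m : ℕ, m ≤ n + 1 → t ≠ m) :
    vecG (n + 1) a b β t = fun k : Fin (n + 1 + 1) =>
      sliceIntegral a b β (bernsteinMean (n := n + 1) k) t := by
  have hH : vecH (n + 1) a b β t =
      matP (n + 1) *ᵥ fun k : Fin (n + 1 + 1) =>
      sliceIntegral a b β (bernsteinMean (n := n + 1) k) t := by
    funext p
    have hp : (p : ℕ) ≤ n + 1 := Nat.lt_succ_iff.mp p.isLt
    have h1 : H (n + 1) a b β p t = sliceIntegral a b β
        (fun x : Fin (n + 1) → ℝ => ∑ k : Fin (n + 1 + 1),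
          ((n + 1 - (p : ℕ)).choose (n + 1 - k) : ℝ) * bernsteinMean k x) t := by
      rw [H, integrand_eq, sliceIntegral, deltaIntegral_succ, deltaIntegral_succ,
        ← integral_const_mul]
      refine integral_congr_ae (ae_of_all _ fun y => ?_)
      simp only [← eval_esymm_div_choose hp]
      ring
    rw [vecH, h1]
    exact sliceIntegral_sum ha hb hβ Finset.univ _
      (fun k : Fin (n + 1 + 1) => continuous_bernsteinMean (n := n + 1) k) ht
  rw [vecG, hH, Matrix.mulVec_mulVec, Matrix.nonsing_inv_mul _ (isUnit_det_matP _),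
    Matrix.one_mulVec]

theorem exists_Icc_ne_nat {t : ℝ} (ht : ∀ m : ℕ, m ≤ n → t ≠ m) :
    ∃ r : ℝ, 0 < r ∧ ∀ s ∈ Set.Icc (t - r) (t + r), ∀ m : ℕ, m ≤ n → s ≠ m := by
  obtain ⟨r, hr, hrt⟩ := exists_pos_le_dist_nat ht
  refine ⟨r / 2, by positivity, fun s hs m hm hsm => ?_⟩
  have h1 := hrt m hm
  rw [← hsm] at h1
  have h2 : |t - s| ≤ r / 2 := abs_le.mpr ⟨by linarith [hs.2], by linarith [hs.1]⟩
  linarith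

/-- The test function depends on x only through ∑ x_l, so disintegration along the slices turns the
weak identity on the cube into one on the line. -/
theorem sliceIntegral_weak (ha : -1 < a) (hb : 0 < b) (hβ : 0 ≤ β) {φ φ' : ℝ → ℝ}
    (hφ : ∀ t, HasDerivAt φ (φ' t) t) (hφ' : Continuous φ') (j : ℕ) :
    (∫ t, φ' t * ((t - ((n + 1 : ℕ) : ℝ) + j) * sliceIntegral a b β
        (fun x : Fin (n + 1) → ℝ => (linProd Finset.univ x).coeff j) t)) +
      ∫ t, φ t * sliceIntegral a b β
        (fun x : Fin (n + 1) → ℝ => (divergencePoly a b β x).coeff j) t = 0 := by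
  have hφc : Continuous φ := continuous_iff_continuousAt.mpr fun t => (hφ t).continuousAt
  have hS : Continuous fun x : Fin (n + 1) → ℝ => ∑ l, x l := by fun_prop
  have hV := continuous_regVandermonde_right (n := n + 1) hβ 0
  have hψc : Continuous fun t : ℝ => φ' t * (t - ((n + 1 : ℕ) : ℝ) + j) := by fun_prop
  have i1 : Integrable fun x : Fin (n + 1) → ℝ =>
      (φ' (∑ l, x l) * (∑ l, x l - ((n + 1 : ℕ) : ℝ) + j)) *
        ((regVandermonde β 0 x * (linProd Finset.univ x).coeff j) *
          ∏ l, betaWeight a b (x l)) := by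
    refine (integrable_mul_prod_betaWeight ha hb ((hψc.comp hS).mul
      (hV.mul (continuousCoeff_linProd Finset.univ j)))).congr (ae_of_all _ fun x => ?_)
    exact mul_assoc _ _ _
  have i2 : Integrable fun x : Fin (n + 1) → ℝ => φ (∑ l, x l) *
        ((regVandermonde β 0 x * (divergencePoly a b β x).coeff j) *
          ∏ l, betaWeight a b (x l)) := by
    refine (integrable_mul_prod_betaWeight ha hb ((hφc.comp hS).mul
      (hV.mul (continuous_coeff_divergencePoly a b β j)))).congr (ae_of_all _ fun x => ?_)
    exact mul_assoc _ _ _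
  have e1 := integral_eq_integral_deltaIntegral
    (φ := fun t => φ' t * (t - ((n + 1 : ℕ) : ℝ) + j)) i1
  have e2 := integral_eq_integral_deltaIntegral i2
  simp only [← mul_assoc (φ' _)]
  refine (congrArg₂ (· + ·) e1.symm e2.symm).trans ?_
  refine (integral_add i1 i2).symm.trans (Eq.trans ?_
    (integral_weak_eq_zero (n := n) ha hb hβ hφ hφ' j))
  refine integral_congr_ae (ae_of_all _ fun x => ?_)
  simp only
  ring

theorem hasDerivAt_sliceIntegral (ha : -1 < a) (hb : 0 < b) (hβ : 0 ≤ β) (j : ℕ) {t : ℝ}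
    (ht : ∀ m : ℕ, m ≤ n + 1 → t ≠ m) :
    HasDerivAt (fun t => (t - ((n + 1 : ℕ) : ℝ) + j) * sliceIntegral a b β
        (fun x : Fin (n + 1) → ℝ => (linProd Finset.univ x).coeff j) t)
      (sliceIntegral a b β (fun x : Fin (n + 1) → ℝ => (divergencePoly a b β x).coeff j) t) t := by
  obtain ⟨r, hr, hrt⟩ := exists_Icc_ne_nat ht
  refine hasDerivAt_of_weak (A := t - r) (B := t + r) (by linarith) (fun s hs => ?_) (fun s hs => ?_)
    (fun φ φ' hφ hφ' _ => sliceIntegral_weak ha hb hβ hφ hφ' j) ⟨by linarith, by linarith⟩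
  · exact (ContinuousAt.mul (by fun_prop) (continuousAt_sliceIntegral ha hb hβ
      (continuousCoeff_linProd _ j) (hrt s hs))).continuousWithinAt
  · exact (continuousAt_sliceIntegral ha hb hβ
      (continuous_coeff_divergencePoly a b β j) (hrt s hs)).continuousWithinAt

theorem hasDerivAt_sliceIntegral_bernsteinMean (ha : -1 < a) (hb : 0 < b) (hβ : 0 ≤ β) {j : ℕ}
    (hj : j ≤ n + 1) {t : ℝ} (ht : ∀ m : ℕ, m ≤ n + 1 → t ≠ m) :
    HasDerivAt (fun t => (t - ((n + 1 : ℕ) : ℝ) + j) *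
        sliceIntegral a b β (bernsteinMean (n := n + 1) j) t)
      (entryU (n + 1 : ℕ) b β j * sliceIntegral a b β (bernsteinMean (n := n + 1) (j - 1)) t +
        (entryV (n + 1 : ℕ) a b β j + 1) * sliceIntegral a b β (bernsteinMean (n := n + 1) j) t +
        entryW (n + 1 : ℕ) a b β j * sliceIntegral a b β (bernsteinMean (n := n + 1) (j + 1)) t)
      t := by
  have hC : (((n + 1).choose j : ℕ) : ℝ) ≠ 0 := by exact_mod_cast (Nat.choose_pos hj).ne'
  have h := (hasDerivAt_sliceIntegral ha hb hβ j ht).const_mul (((n + 1).choose j : ℕ) : ℝ)⁻¹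
  have hf : (fun t => (t - ((n + 1 : ℕ) : ℝ) + j) *
      sliceIntegral a b β (bernsteinMean (n := n + 1) j) t) = fun t =>
      (((n + 1).choose j : ℕ) : ℝ)⁻¹ * ((t - ((n + 1 : ℕ) : ℝ) + j) * sliceIntegral a b β
        (fun x : Fin (n + 1) → ℝ => (linProd Finset.univ x).coeff j) t) := by
    funext t
    have : sliceIntegral a b β (bernsteinMean (n := n + 1) j) t =
        (((n + 1).choose j : ℕ) : ℝ)⁻¹ * sliceIntegral a b β
          (fun x : Fin (n + 1) → ℝ => (linProd Finset.univ x).coeff j) t := by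
      rw [sliceIntegral, sliceIntegral, deltaIntegral_succ, deltaIntegral_succ,
        ← integral_const_mul]
      refine integral_congr_ae (ae_of_all _ fun y => ?_)
      simp only [bernsteinMean]
      ring
    rw [this]
    ring
  rw [hf]
  refine h.congr_deriv ?_
  have hd : (fun x : Fin (n + 1) → ℝ => (divergencePoly a b β x).coeff j) = fun x =>
      ∑ i : Fin 3, (((n + 1).choose j : ℕ) : ℝ) * ![entryU (n + 1 : ℕ) b β j,
        entryV (n + 1 : ℕ) a b β j + 1, entryW (n + 1 : ℕ) a b β j] i *
        bernsteinMean (![j - 1, j, j + 1] i) x := by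
    funext x
    rw [coeff_divergencePoly a b β x hj, Fin.sum_univ_three]
    simp only [Matrix.cons_val_zero, Matrix.cons_val_one, Matrix.cons_val]
    ring
  rw [hd, sliceIntegral_sum ha hb hβ _ _ (fun i => continuous_bernsteinMean _) ht,
    Fin.sum_univ_three]
  simp only [Matrix.cons_val_zero, Matrix.cons_val_one, Matrix.cons_val]
  field_simp

/-- Letting `g` live on all of ℕ avoids boundary cases: the out-of-range terms carry the
coefficients u_0 = 0 and w_N = 0. -/
theorem matX_mulVec {N : ℕ} (g : ℕ → ℝ) (j : Fin (N + 1)) :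
    (matX N a b β *ᵥ fun k : Fin (N + 1) => g k) j =
      entryU N b β (j : ℕ) * g (j - 1) + entryV N a b β (j : ℕ) * g j +
        entryW N a b β (j : ℕ) * g (j + 1) := by
  have hj : (j : ℕ) < N + 1 := j.isLt
  have h1 : (matX N a b β *ᵥ fun k : Fin (N + 1) => g k) j =
      ∑ k : Fin (N + 1), ((if (k : ℕ) + 1 = j then entryU N b β (j : ℕ) * g k else 0) +
        (if (k : ℕ) = j then entryV N a b β (j : ℕ) * g k else 0) +
        (if (k : ℕ) = j + 1 then entryW N a b β (j : ℕ) * g k else 0)) := by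
    simp only [Matrix.mulVec, dotProduct, matX, Matrix.of_apply]
    refine Finset.sum_congr rfl fun k _ => ?_
    by_cases c1 : (k : ℕ) + 1 = j
    · rw [if_pos c1, if_pos c1, if_neg (by omega), if_neg (by omega)]; ring
    · by_cases c2 : k = j
      · have : (k : ℕ) = j := congrArg _ c2
        rw [if_neg c1, if_neg c1, if_pos c2, if_pos this, if_neg (by omega)]; ring
      · have : (k : ℕ) ≠ j := fun h => c2 (Fin.ext h)
        rw [if_neg c1, if_neg c1, if_neg c2, if_neg this]
        split_ifs <;> ring
  rw [h1, ← Finset.sum_range fun k => ((if k + 1 = (j : ℕ) then entryU N b β (j : ℕ) * g k else 0) +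
        (if k = (j : ℕ) then entryV N a b β (j : ℕ) * g k else 0) +
        (if k = (j : ℕ) + 1 then entryW N a b β (j : ℕ) * g k else 0)),
    Finset.sum_add_distrib, Finset.sum_add_distrib, Finset.sum_ite_eq', Finset.sum_ite_eq',
    if_pos (Finset.mem_range.mpr hj)]
  congr 1
  · congr 1
    rcases Nat.eq_zero_or_pos (j : ℕ) with h0 | h0
    · rw [h0]
      simp [entryU]
    · have : ∀ k : ℕ, k + 1 = j ↔ k = j - 1 := fun k => by omega
      simp only [this, Finset.sum_ite_eq']
      rw [if_pos (Finset.mem_range.mpr (by omega))]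
  · split_ifs with h
    · rfl
    · have : (j : ℕ) = N := by rw [Finset.mem_range] at h; omega
      rw [this]
      simp [entryW]

theorem matΛ_add_mulVec {N : ℕ} (t : ℝ) (v : Fin (N + 1) → ℝ) (j : Fin (N + 1)) :
    ((matΛ N + t • (1 : Matrix (Fin (N + 1)) (Fin (N + 1)) ℝ)) *ᵥ v) j =
      (t - N + (j : ℕ)) * v j := by
  rw [matΛ, Matrix.add_mulVec, Matrix.neg_mulVec, Matrix.smul_mulVec, Matrix.one_mulVec]
  simp only [Pi.add_apply, Pi.neg_apply, Pi.smul_apply, Matrix.mulVec_diagonal, smul_eq_mul]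
  ring

/-- The differential equation off the integers, in the form
`((t - N + j) G_j)' = (X G)_j + G_j`. -/
theorem hasDerivAt_mul_vecG (ha : -1 < a) (hb : 0 < b) (hβ : 0 ≤ β) {t : ℝ}
    (ht : ∀ m : ℕ, m ≤ n + 1 → t ≠ m) (j : Fin (n + 1 + 1)) :
    HasDerivAt (fun s => (s - ((n + 1 : ℕ) : ℝ) + (j : ℕ)) * vecG (n + 1) a b β s j)
      ((matX (n + 1) a b β *ᵥ vecG (n + 1) a b β t) j + vecG (n + 1) a b β t j) t := by
  have h := hasDerivAt_sliceIntegral_bernsteinMean ha hb hβ (Nat.lt_succ_iff.mp j.isLt) ht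
  rw [vecG_eq ha hb hβ ht,
    matX_mulVec fun k => sliceIntegral a b β (bernsteinMean (n := n + 1) k) t]
  refine (h.congr_deriv (by ring)).congr_of_eventuallyEq ?_
  obtain ⟨r, hr, hrt⟩ := exists_Icc_ne_nat ht
  filter_upwards [Icc_mem_nhds (by linarith : t - r < t) (by linarith : t < t + r)] with s hs
  rw [vecG_eq ha hb hβ (hrt s hs)]

theorem differentiableAt_vecG (ha : -1 < a) (hb : 0 < b) (hβ : 0 ≤ β) {t : ℝ}
    (ht : ∀ m : ℕ, m ≤ n + 1 → t ≠ m) : DifferentiableAt ℝ (vecG (n + 1) a b β) t := by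
  refine differentiableAt_pi.mpr fun j => ?_
  have hj : (j : ℕ) ≤ n + 1 := Nat.lt_succ_iff.mp j.isLt
  have hne : ∀ s : ℝ, (∀ m : ℕ, m ≤ n + 1 → s ≠ m) → s - ((n + 1 : ℕ) : ℝ) + (j : ℕ) ≠ 0 := by
    intro s hs h
    refine hs (n + 1 - j) (Nat.sub_le _ _) ?_
    rw [Nat.cast_sub hj]
    linarith
  have h1 : DifferentiableAt ℝ (fun s => ((s - ((n + 1 : ℕ) : ℝ) + (j : ℕ)) *
      vecG (n + 1) a b β s j) / (s - ((n + 1 : ℕ) : ℝ) + (j : ℕ))) t :=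
    (hasDerivAt_mul_vecG ha hb hβ ht j).differentiableAt.fun_div (by fun_prop) (hne t ht)
  refine h1.congr_of_eventuallyEq ?_
  obtain ⟨r, hr, hrt⟩ := exists_Icc_ne_nat ht
  filter_upwards [Icc_mem_nhds (by linarith : t - r < t) (by linarith : t < t + r)] with s hs
  rw [mul_div_cancel_left₀ _ (hne s (hrt s hs))]

/-- Only a punctured, one-sided neighbourhood is claimed, so t itself may be one of the integers. -/
theorem exists_Ioo_ne_nat (n : ℕ) (t : ℝ) : ∃ r : ℝ, 0 < r ∧
    ∀ s ∈ Set.Ioo t (t + r), ∀ m : ℕ, m ≤ n → s ≠ m := by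
  have hfin : ((fun m : ℕ => (m : ℝ)) '' Set.Iic n \ {t}).Finite :=
    ((Set.finite_Iic n).image _).sdiff
  obtain ⟨r, hr, hball⟩ := Metric.isOpen_iff.mp hfin.isClosed.isOpen_compl t (by simp)
  refine ⟨r, hr, fun s hs m hm hsm => hball (a := s) ?_ ⟨⟨m, hm, hsm.symm⟩, hs.1.ne'⟩⟩
  rw [Metric.mem_ball, Real.dist_eq, abs_lt]
  constructor <;> linarith [hs.1, hs.2]

theorem differential_equation (ha : -1 < a) (hb : 0 < b) (hβ : 0 ≤ β) {t : ℝ}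
    (hG : DifferentiableAt ℝ (vecG (n + 1) a b β) t) :
    (matΛ (n + 1) + t • (1 : Matrix (Fin (n + 1 + 1)) (Fin (n + 1 + 1)) ℝ)) *ᵥ
      deriv (vecG (n + 1) a b β) t = matX (n + 1) a b β *ᵥ vecG (n + 1) a b β t := by
  funext j
  rw [matΛ_add_mulVec]
  obtain ⟨r, hr, hrt⟩ := exists_Ioo_ne_nat (n + 1) t
  set z : ℝ → ℝ := fun s => (s - ((n + 1 : ℕ) : ℝ) + (j : ℕ)) * vecG (n + 1) a b β s j with hz
  have hGj : HasDerivAt (fun s => vecG (n + 1) a b β s j) (deriv (vecG (n + 1) a b β) t j) t :=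
    hasDerivAt_pi.mp hG.hasDerivAt j
  have hlin : HasDerivAt (fun s : ℝ => s - ((n + 1 : ℕ) : ℝ) + (j : ℕ)) 1 t :=
    ((hasDerivAt_id t).sub_const _).add_const _
  have hz1 := hlin.fun_mul hGj
  have hcont : ContinuousAt (fun s => (matX (n + 1) a b β *ᵥ vecG (n + 1) a b β s) j +
      vecG (n + 1) a b β s j) t := by
    have h1 : ContinuousAt (fun s => matX (n + 1) a b β *ᵥ vecG (n + 1) a b β s) t :=
      (Continuous.matrix_mulVec continuous_const continuous_id).continuousAt.comp hG.continuousAt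
    exact (continuousAt_pi.mp h1 j).add hGj.continuousAt
  have hmem : Set.Ioo t (t + r) ∈ 𝓝[>] t := Ioo_mem_nhdsGT (by linarith)
  -- Just to the right of t the derivative of z is (X G)_j + G_j, which is continuous at t because G
  -- is. Its limit is therefore the right derivative of z at t, which must agree with the product
  -- rule.
  have hz2 : HasDerivWithinAt z ((matX (n + 1) a b β *ᵥ vecG (n + 1) a b β t) j +
      vecG (n + 1) a b β t j) (Set.Ici t) t := by
    refine hasDerivWithinAt_Ici_of_tendsto_deriv (s := Set.Ioo t (t + r)) (fun s hs =>
      (hasDerivAt_mul_vecG ha hb hβ (hrt s hs) j).differentiableAt.differentiableWithinAt)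
      hz1.continuousAt.continuousWithinAt hmem ?_
    refine (hcont.tendsto.mono_left nhdsWithin_le_nhds).congr' ?_
    filter_upwards [hmem] with s hs
    exact (hasDerivAt_mul_vecG ha hb hβ (hrt s hs) j).deriv.symm
  have := (uniqueDiffOn_Ici t t Set.self_mem_Ici).eq_deriv _ hz1.hasDerivWithinAt hz2
  linarith

end

end JacobiTrace

end

theorem proposition3p7 (N : ℕ) (hN : 1 ≤ N) (a b β : ℝ) (ha : -1 < a) (hb : 0 < b) (hβ : 0 ≤ β) :
    (∀ t : ℝ, (∀ m : ℕ, m ≤ N → t ≠ m) →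
      (∀ p : ℕ, p ≤ N → JacobiTrace.DeltaIntegrable (JacobiTrace.integrand N a b β p) t) ∧
      DifferentiableAt ℝ (JacobiTrace.vecG N a b β) t) ∧
    (∀ t : ℝ,
      (∀ p : ℕ, p ≤ N → JacobiTrace.DeltaIntegrable (JacobiTrace.integrand N a b β p) t) →
      DifferentiableAt ℝ (JacobiTrace.vecG N a b β) t →
      (JacobiTrace.matΛ N + t • (1 : Matrix (Fin (N + 1)) (Fin (N + 1)) ℝ)) *ᵥ
          deriv (JacobiTrace.vecG N a b β) t =
        JacobiTrace.matX N a b β *ᵥ JacobiTrace.vecG N a b β t) := by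
  obtain ⟨n, rfl⟩ : ∃ n, N = n + 1 := ⟨N - 1, by omega⟩
  exact ⟨fun t ht => ⟨fun p _ => JacobiTrace.deltaIntegrable_integrand ha hb hβ p ht,
    JacobiTrace.differentiableAt_vecG ha hb hβ ht⟩,
    fun t _ hG => JacobiTrace.differential_equation ha hb hβ hG⟩
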